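/- **Theorem 4.9 (Saturation for spectral regularization operators with maximal qualification).** Let $X,Y$ be (real or complex) Hilbert spaces, $T:X\to Y$ a compact injective linear operator, $0<\alpha_0\le\|T\|^2$, and $g_\alpha:[0,\|T\|^2]\to\mathbb R$, $\alpha\in(0,\alpha_0)$, a family of functions with * H1: every $g_\alpha$ is piecewise continuous on $[0,\|T\|^2]$; * H2: there is $C>0$ with $|\lambda g_\alpha(\lambda)|\le C$ for all $\lambda\in[0,\|T\|^2]$, $\alpha\in(0,\alpha_0)$; * H3: $\lim_{\alpha\to0^+}g_\alpha(\lambda)=1/\lambda$ for every $\lambda\in(0,\|T\|^2]$; * H4: $\sup_{\lambda\in[0,\|T\|^2]}\sqrt\lambda\,|g_\alpha(\lambda)|=O(1/\sqrt\alpha)$ as $\alpha\to0^+$. Put $r_\alpha(\lambda)=1-\lambda g_\alpha(\lambda)$ and $R_\alpha=g_\alpha(T^*T)T^*$. Suppose that * M1: there are eigenvalues $\tilde\lambda_n>0$ of $TT^*$ ($n\in\mathbb N$) and $c\ge1$ with $\tilde\lambda_n\downarrow0$ and $\tilde\lambda_n/\tilde\lambda_{n+1}\le c$ for all $n$; * M2: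 there are positive constants $\lambda_1\le\|T\|^2$, $\gamma_1,\gamma_2$ and $c_1>1$ such that, for $\alpha\in(0,\alpha_0)$: (a) $0\le r_\alpha(\lambda)\le1$ for $0\le\lambda\le\lambda_1$; (b) $r_\alpha(\lambda)\ge\gamma_1$ for $0\le\lambda<\alpha\le\lambda_1$; (c) for each $\lambda\in(0,\|T\|^2]$, $|r_\alpha(\lambda)|$ is nondecreasing in $\alpha$; (d) $g_\alpha(c_1\alpha)\ge\gamma_2/\alpha$ if $c_1\alpha\le\lambda_1$; (e) $g_\alpha(\lambda)\ge g_\alpha(\tilde\lambda)$ for $\alpha\le\lambda\le\tilde\lambda\le\lambda_1$; * M3: there are $\beta\ge0$ and a strictly increasing $\rho:(0,\|T\|^2]\to(0,\infty)$ that is of local upper type $\beta$ (that is, $\rho$ is continuous, $\rho(t)\to0$ as $t\to0^+$, and for some $d>0$, $\rho(t)\le d\,s^{-\beta}\rho(st)$ for all $s\in(0,1]$, $t\in(0,\|T\|^2]$) and a maximal qualification of $\{R_\alpha\}$ (that is, for some $\gamma>0$, $|r_\alpha(\lambda)|\rho(\lambda)\le\gamma\rho(\alpha)$ for all $\lambda\in(0,\|T\|^2]$,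 $\alpha\in(0,\alpha_0)$, and $\inf_{\alpha\in(0,\alpha_0)}|r_\alpha(\lambda)|/\rho(\alpha)>0$ for every $\lambda\in(0,\|T\|^2]$), and there are $a,k>0$ with $\rho(\lambda)|r_\alpha(\lambda)|/\rho(\alpha)\ge a$ whenever $\alpha\in(0,\alpha_0)$ and $k\alpha\le\lambda\le\|T\|^2$; * M4: $\lambda\mapsto|r_\alpha(\lambda)|^2$ is convex on $(0,\|T\|^2]$ for every $\alpha\in(0,\alpha_0)$. Let $\Theta(t)=\sqrt t\,\rho(t)$ for $t\in(0,\|T\|^2]$; it maps $(0,\alpha_0)$ bijectively onto $(0,\Theta(\alpha_0))$. Then $\psi(x,\delta)=\rho(\Theta^{-1}(\delta))$, for $x\in X^\rho=\mathcal R(\rho(T^*T))\setminus\{0\}$ and $\delta\in(0,\Theta(\alpha_0))$, is a global saturation function of $\{R_\alpha\}_{\alpha\in(0,\alpha_0)}$ on $X^\rho$. Here the total error is $E(x,\delta)=\inf_{\alpha\in(0,\alpha_0)}\ \sup_{\|y-Tx\|\le\delta}\|R_\alpha y-x\|$. For nonempty $M\subset X\setminus\{0\}$, $\mathcal F_M$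 is the set of $\psi:M\times(0,a)\to(0,\infty)$ (some $a>0$) that for each $x\in M$ are continuous and nondecreasing in $\delta$ and tend to $0$ as $\delta\to0^+$; $\psi\in\mathcal F_M$ is an upper bound of convergence for $E$ on $M$ if there are $r>0$ and $p:M\to(0,\infty)$ with $E(x,\delta)\le p(x)\psi(x,\delta)$ for $x\in M$, $\delta\in(0,r)$. A global saturation function on $M$ is an upper bound of convergence $\psi$ on $M$ such that * S1: $\limsup_{\delta\to0^+}E(x^*,\delta)/\psi(x,\delta)>0$ for all $x^*\in X\setminus\{0\}$, $x\in M$; * S2: $\psi$ is invariant over $M$: there are $d>0$ and $\kappa:M\times M\to(0,\infty)$ with $\psi(x,\delta)\le\kappa(x,\tilde x)\psi(\tilde x,\delta)$ for $x,\tilde x\in M$, $\delta\in(0,d)$; * S3: no upper bound of convergence for $E$ on a set $\tilde M\supsetneq M$, $0\notin\tilde M$, that coincides with $\psi$ on $M$ (for all small $\delta$) satisfies S1 and S2 on $\tilde M$. -/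

import Mathlib

open Filter Topology Set

noncomputable section

namespace GlobalSaturation

/-! ### Orders of convergence and their comparison -/

section Orders

variable {X : Type*}

/-- `ψ` is a `δ`-order of convergence on `M × (0, a)`: it is positive there and, for each `x ∈ M`,
it is continuous and increasing in `δ ∈ (0, a)` and tends to `0` as `δ → 0⁺`.  Functions on
`M × (0, a)` are represented by total functions, whose values elsewhere are irrelevant. -/
structure IsOrderOn (M : Set X) (a : ℝ) (ψ : X → ℝ → ℝ) : Prop where
  pos : ∀ x ∈ M, ∀ δ ∈ Ioo 0 a, 0 < ψ x δ
  tendsto : ∀ x ∈ M, Tendsto (ψ x) (𝓝[>] 0) (𝓝 0)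
  continuousOn : ∀ x ∈ M, ContinuousOn (ψ x) (Ioo 0 a)
  monotoneOn : ∀ x ∈ M, MonotoneOn (ψ x) (Ioo 0 a)

/-- The class `F_M` of orders of convergence on `M`. -/
def IsOrder (M : Set X) (ψ : X → ℝ → ℝ) : Prop :=
  ∃ a : ℝ, 0 < a ∧ IsOrderOn M a ψ

/-- `ψ` precedes `ψ'` on `M`. -/
def Precedes (M : Set X) (ψ ψ' : X → ℝ → ℝ) : Prop :=
  ∃ r : ℝ, 0 < r ∧ ∃ p : X → ℝ, (∀ x ∈ M, 0 < p x) ∧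
    ∀ x ∈ M, ∀ δ ∈ Ioo 0 r, ψ x δ ≤ p x * ψ' x δ

/-- `ψ` on `M` precedes `ψ'` on `M'`. -/
def PrecedesOn (M M' : Set X) (ψ ψ' : X → ℝ → ℝ) : Prop :=
  ∃ d : ℝ, 0 < d ∧ ∃ k : X → X → ℝ, (∀ x ∈ M, ∀ x' ∈ M', 0 < k x x') ∧
    ∀ x ∈ M, ∀ x' ∈ M', ∀ δ ∈ Ioo 0 d, ψ x δ ≤ k x x' * ψ' x' δ

/-- `ψ` on `M` is equivalent to `ψ'` on `M'`. -/
def EquivOn (M M' : Set X) (ψ ψ' : X → ℝ → ℝ) : Prop :=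
  PrecedesOn M M' ψ ψ' ∧ PrecedesOn M' M ψ' ψ

/-- `ψ` is invariant over `M`. -/
def InvariantOver (M : Set X) (ψ : X → ℝ → ℝ) : Prop :=
  EquivOn M M ψ ψ

end Orders

/-! ### Total error and global saturation -/

section Saturation

variable {X Y : Type*} [NormedAddCommGroup X] [NormedAddCommGroup Y]

/-- The total error of the family `R α`, `α ∈ (0, α₀)`, for the problem `T x = y`, at `x` for the
noise level `δ`: the infimum over `α` of the supremum of `‖R α y - x‖` over the closed ball of
radius `δ` about `T x`.  Infimum and supremum are taken in `[0, ∞]`; the result is finite as soon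
as one `R α` is bounded on bounded sets. -/
def totalError (T : X → Y) (R : ℝ → Y → X) (α₀ : ℝ) (x : X) (δ : ℝ) : ℝ :=
  (⨅ α ∈ Ioo 0 α₀, ⨆ y ∈ Metric.closedBall (T x) δ, ‖R α y - x‖ₑ).toReal

/-- `ψ` is an upper bound of convergence on `M` for the total error `E`.  The sets `M` under
consideration are nonempty and do not contain `0`. -/
structure IsUpperBound (E : X → ℝ → ℝ) (M : Set X) (ψ : X → ℝ → ℝ) : Prop where
  nonempty : M.Nonempty
  zero_notMem : (0 : X) ∉ M
  isOrder : IsOrder M ψ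
  precedes : Precedes M E ψ

/-- Condition S1.  The limit superior is taken in the extended reals, since it may be `+∞`. -/
def CondS1 (E : X → ℝ → ℝ) (M : Set X) (ψ : X → ℝ → ℝ) : Prop :=
  ∀ z : X, z ≠ 0 → ∀ x ∈ M,
    0 < limsup (fun δ : ℝ => ((E z δ / ψ x δ : ℝ) : EReal)) (𝓝[>] 0)

/-- `ψ'` on `M'` is a proper extension of `ψ` on `M` in the variable `x`.  The intervals of
definition in `δ` need not be the same, only the behaviour near `δ = 0` matters. -/
def IsProperExtension (M : Set X) (ψ : X → ℝ → ℝ) (M' : Set X) (ψ' : X → ℝ → ℝ) : Prop :=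
  M ⊂ M' ∧ ∃ r : ℝ, 0 < r ∧ ∀ x ∈ M, ∀ δ ∈ Ioo 0 r, ψ' x δ = ψ x δ

/-- `ψ` is a global saturation function over `M` of a method with total error `E`. -/
structure IsGlobalSaturation (E : X → ℝ → ℝ) (M : Set X) (ψ : X → ℝ → ℝ) : Prop where
  isUpperBound : IsUpperBound E M ψ
  s1 : CondS1 E M ψ
  s2 : InvariantOver M ψ
  s3 : ¬ ∃ (M' : Set X) (ψ' : X → ℝ → ℝ), IsUpperBound E M' ψ' ∧
    IsProperExtension M ψ M' ψ' ∧ CondS1 E M' ψ' ∧ InvariantOver M' ψ'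

end Saturation

/-! ### Functions of a compact self-adjoint operator -/

section Spectral

variable {𝕜 X Y : Type*} [RCLike 𝕜]
  [NormedAddCommGroup X] [InnerProductSpace 𝕜 X] [CompleteSpace X]
  [NormedAddCommGroup Y] [InnerProductSpace 𝕜 Y] [CompleteSpace Y]

/-- The orthogonal projection onto the eigenspace `ker (A - μ)` (it is `0` unless `μ` is an
eigenvalue of `A`). -/
def eigenProj (A : X →L[𝕜] X) (μ : ℝ) : X →L[𝕜] X :=
  (A - (μ : 𝕜) • ContinuousLinearMap.id 𝕜 X).ker.starProjection

/-- `f(A) x = ∫ f(μ) dE_μ x` for a compact self-adjoint operator `A`, whose spectral family is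
`E_μ = ∑_{ν ≤ μ} eigenProj A ν`; so `f(A) x = ∑_μ f(μ) eigenProj A μ x`, the sum being over the
eigenvalues.  It converges unconditionally if `f` is bounded on the set of eigenvalues. -/
def spectralApply (A : X →L[𝕜] X) (f : ℝ → ℝ) (x : X) : X :=
  ∑' μ : ℝ, (f μ : 𝕜) • eigenProj A μ x

/-- The operator `T* T`. -/
def normalOp (T : X →L[𝕜] Y) : X →L[𝕜] X :=
  (ContinuousLinearMap.adjoint T).comp T

/-- The spectral regularization operators `R_α = g_α(T* T) T*`. -/
def spectralReg (T : X →L[𝕜] Y) (g : ℝ → ℝ → ℝ) (α : ℝ) (y : Y) : X :=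
  spectralApply (normalOp T) (g α) (ContinuousLinearMap.adjoint T y)

/-- The source set `X^ρ = R(ρ(T* T)) \ {0}`. -/
def sourceSet (T : X →L[𝕜] Y) (ρ : ℝ → ℝ) : Set X :=
  Set.range (spectralApply (normalOp T) ρ) \ {0}

end Spectral

/-! ### Families of functions generating spectral methods -/

/-- `f` is piecewise continuous on `[a, b]`: continuous up to finitely many points, with finite
one-sided limits everywhere. -/
def PiecewiseContinuousOn (f : ℝ → ℝ) (a b : ℝ) : Prop :=
  (∃ s : Finset ℝ, ∀ t ∈ Icc a b, t ∉ s → ContinuousWithinAt f (Icc a b) t) ∧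
  (∀ t ∈ Ioc a b, ∃ l : ℝ, Tendsto f (𝓝[<] t) (𝓝 l)) ∧
  (∀ t ∈ Ico a b, ∃ l : ℝ, Tendsto f (𝓝[>] t) (𝓝 l))

/-- The residual function `r_α(l) = 1 - l g_α(l)`. -/
def residual (g : ℝ → ℝ → ℝ) (α l : ℝ) : ℝ := 1 - l * g α l

/-- `ρ : (0, b] → (0, ∞)` is a qualification of the method generated by `g_α`, `α ∈ (0, α₀)`. -/
structure IsQualification (g : ℝ → ℝ → ℝ) (α₀ b : ℝ) (ρ : ℝ → ℝ) : Prop where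
  pos : ∀ l ∈ Ioc 0 b, 0 < ρ l
  monotoneOn : MonotoneOn ρ (Ioc 0 b)
  bound : ∃ γ : ℝ, 0 < γ ∧ ∀ α ∈ Ioo 0 α₀, ∀ l ∈ Ioc 0 b, |residual g α l| * ρ l ≤ γ * ρ α

/-- `ρ` is a maximal qualification. -/
structure IsMaximalQualification (g : ℝ → ℝ → ℝ) (α₀ b : ℝ) (ρ : ℝ → ℝ) : Prop
    extends IsQualification g α₀ b ρ where
  maximal : ∀ l ∈ Ioc 0 b, ∃ c : ℝ, 0 < c ∧ ∀ α ∈ Ioo 0 α₀, c ≤ |residual g α l| / ρ α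

/-- `ρ : (0, b] → (0, ∞)` is of local upper type `β`. -/
structure IsLocalUpperType (ρ : ℝ → ℝ) (b β : ℝ) : Prop where
  pos : ∀ t ∈ Ioc 0 b, 0 < ρ t
  continuousOn : ContinuousOn ρ (Ioc 0 b)
  monotoneOn : MonotoneOn ρ (Ioc 0 b)
  tendsto : Tendsto ρ (𝓝[>] 0) (𝓝 0)
  bound : ∃ d : ℝ, 0 < d ∧ ∀ s ∈ Ioc (0 : ℝ) 1, ∀ t ∈ Ioc 0 b, ρ t ≤ d * (1 / s) ^ β * ρ (s * t)

end GlobalSaturation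

end

/-!
In the eigenspace decomposition of `T* T` the error for exact data, `R_α T x - x`, has the components
`-r_α(μ) P_μ x`, while `‖R_α‖` is governed by `sup √μ |g_α(μ)|`. Write the noise level as
`δ = Θ(t) = √t ρ(t)`, so that `ψ = ρ(t)`.

*Upper bound.* With the choice `α = t`, the qualification property bounds the approximation error on
the source set by a multiple of `ρ(t)`, and `‖R_t‖ ≤ B / √t` bounds the propagated noise by
`B ρ(t)` (`totalError_le_of_mem_range`).

*Lower bounds.* Since the eigenvalues of `T T*` meet each interval `[c₁ α, c c₁ α]` near `0`, and
`g_α(λ)` is nonincreasing in `α`, the operator `R_α` amplifies noise by at least `q / √α`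
(`exists_le_sqrt_mul_abs`). Hence a parameter achieving the accuracy `K ρ(t)` at the noise level
`Θ(t)` must satisfy `α ≥ min(1, (q / 2K)²) t` (`min_mul_le_parameter`). For small `K` this reads
`α ≥ t`, and then the maximality of the qualification prevents the approximation error of a
nonzero element from being smaller than a multiple of `ρ(t)`: this is S1
(`exists_mul_le_totalError`).

*Maximality.* Condition S2 is clear, as `ψ` does not depend on `x`. If `ψ` had an extension to a
larger set satisfying S2, then the total error of some `x` outside the source set would be of order
`ρ(t)`. By the bound for `α`, by the monotonicity of `|r_α|` in `α` and because `ρ` is of local upper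
type, `‖r_s(T* T) x‖` would be of order `ρ(s)`, and the lower bound `ρ(λ) |r_s(λ)| ≥ a ρ(s)`
for `λ ≥ k s` would then make `∑ ‖P_μ x‖² / ρ(μ)²` finite, so that `x` belongs to the range of
`ρ(T* T)` (`mem_range_of_totalError_le`), a contradiction.
-/

namespace GlobalSaturation

/-! ### The eigenspace decomposition of a compact self-adjoint operator -/

section CompactSelfAdjoint

variable {𝕜 X : Type*} [RCLike 𝕜]
  [NormedAddCommGroup X] [InnerProductSpace 𝕜 X] {A : X →L[𝕜] X}

theorem ker_sub_smul_eq_eigenspace (A : X →L[𝕜] X) (μ : ℝ) :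
    (A - (μ : 𝕜) • ContinuousLinearMap.id 𝕜 X).ker =
      Module.End.eigenspace (A : X →ₗ[𝕜] X) (μ : 𝕜) := by
  ext v
  simp [sub_eq_zero]

theorem mem_ker_sub_smul_iff {μ : ℝ} {x : X} :
    x ∈ (A - (μ : 𝕜) • ContinuousLinearMap.id 𝕜 X).ker ↔ A x = (μ : 𝕜) • x := by
  simp [sub_eq_zero]

theorem inner_of_apply_eq (hS : (A : X →ₗ[𝕜] X).IsSymmetric) {μ ν : ℝ} (hμν : μ ≠ ν) {x y : X}
    (hx : A x = (μ : 𝕜) • x) (hy : A y = (ν : 𝕜) • y) : inner 𝕜 x y = 0 :=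
  hS.orthogonalFamily_eigenspaces (i := (μ : 𝕜)) (j := (ν : 𝕜)) (by exact_mod_cast hμν)
    ⟨x, by simpa [Module.End.mem_eigenspace_iff] using hx⟩
    ⟨y, by simpa [Module.End.mem_eigenspace_iff] using hy⟩

/-- The eigenspaces, indexed by real numbers, form an orthogonal family. -/
theorem orthogonalFamily_ker (hS : (A : X →ₗ[𝕜] X).IsSymmetric) :
    OrthogonalFamily 𝕜
      (fun μ : ℝ => ↥(A - (μ : 𝕜) • ContinuousLinearMap.id 𝕜 X).ker)
      fun μ => (A - (μ : 𝕜) • ContinuousLinearMap.id 𝕜 X).ker.subtypeₗᵢ := by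
  rintro μ ν hμν ⟨x, hx⟩ ⟨y, hy⟩
  exact inner_of_apply_eq hS hμν (mem_ker_sub_smul_iff.1 hx) (mem_ker_sub_smul_iff.1 hy)

variable [CompleteSpace X]

theorem apply_eigenProj (A : X →L[𝕜] X) (μ : ℝ) (x : X) :
    A (eigenProj A μ x) = (μ : 𝕜) • eigenProj A μ x :=
  mem_ker_sub_smul_iff.1 (Submodule.starProjection_apply_mem
    (A - (μ : 𝕜) • ContinuousLinearMap.id 𝕜 X).ker x)

theorem eigenProj_of_apply_eq {μ : ℝ} {x : X} (h : A x = (μ : 𝕜) • x) :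
    eigenProj A μ x = x := by
  exact Submodule.starProjection_eq_self_iff.2 (mem_ker_sub_smul_iff.2 h)

theorem re_inner_eigenProj_left (μ : ℝ) (x : X) :
    RCLike.re (inner 𝕜 (eigenProj A μ x) x) = ‖eigenProj A μ x‖ ^ 2 :=
  Submodule.re_inner_starProjection_eq_normSq _ x

theorem eigenProj_of_apply_eq_of_ne (hS : (A : X →ₗ[𝕜] X).IsSymmetric) {μ ν : ℝ} (hμν : μ ≠ ν)
    {x : X} (hx : A x = (μ : 𝕜) • x) : eigenProj A ν x = 0 := by
  rw [← norm_eq_zero, ← sq_eq_zero_iff, ← re_inner_eigenProj_left,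
    inner_of_apply_eq hS hμν.symm (apply_eigenProj A ν x) hx, map_zero]

theorem eigenProj_eigenProj_of_ne (hS : (A : X →ₗ[𝕜] X).IsSymmetric) {μ ν : ℝ} (hμν : μ ≠ ν)
    (x : X) : eigenProj A ν (eigenProj A μ x) = 0 :=
  eigenProj_of_apply_eq_of_ne hS hμν (apply_eigenProj A μ x)

theorem eigenProj_apply (hS : (A : X →ₗ[𝕜] X).IsSymmetric) (μ : ℝ) (x : X) :
    eigenProj A μ (A x) = (μ : 𝕜) • eigenProj A μ x := by
  refine ext_inner_right 𝕜 fun y => ?_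
  rw [eigenProj, Submodule.inner_starProjection_left_eq_right, ← eigenProj, inner_smul_left,
    eigenProj, Submodule.inner_starProjection_left_eq_right, ← eigenProj]
  have h := hS x (eigenProj A μ y)
  simp only [ContinuousLinearMap.coe_coe] at h
  rw [h, apply_eigenProj, inner_smul_right, RCLike.conj_ofReal]

/-- All eigenvalues being real, the real-indexed eigenspaces span a dense subspace. -/
theorem isHilbertSum_ker (hA : IsCompactOperator A) (hS : (A : X →ₗ[𝕜] X).IsSymmetric) :
    IsHilbertSum 𝕜 (fun μ : ℝ => ↥(A - (μ : 𝕜) • ContinuousLinearMap.id 𝕜 X).ker)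
      fun μ => (A - (μ : 𝕜) • ContinuousLinearMap.id 𝕜 X).ker.subtypeₗᵢ := by
  have : ∀ μ : ℝ, CompleteSpace ↥(A - (μ : 𝕜) • ContinuousLinearMap.id 𝕜 X).ker := fun μ =>
    (A - (μ : 𝕜) • ContinuousLinearMap.id 𝕜 X).isClosed_ker.completeSpace_coe
  refine IsHilbertSum.mkInternal
    (F := fun μ : ℝ => (A - (μ : 𝕜) • ContinuousLinearMap.id 𝕜 X).ker) (orthogonalFamily_ker hS) ?_
  have h := ContinuousLinearMap.orthogonalComplement_iSup_eigenspaces_eq_bot hA hS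
  rw [← Submodule.topologicalClosure_eq_top_iff] at h
  rw [← h]
  refine Submodule.topologicalClosure_mono (iSup_le fun z => ?_)
  by_cases hz : Module.End.HasEigenvalue (A : X →ₗ[𝕜] X) z
  · obtain ⟨r, rfl⟩ := RCLike.conj_eq_iff_real.1 (hS.conj_eigenvalue_eq_self hz)
    rw [← ker_sub_smul_eq_eigenspace]
    exact le_iSup (fun μ : ℝ => (A - (μ : 𝕜) • ContinuousLinearMap.id 𝕜 X).ker) r
  · rw [Module.End.hasEigenvalue_iff, not_not] at hz
    rw [hz]
    exact bot_le

theorem eigenProj_of_hasSum (hS : (A : X →ₗ[𝕜] X).IsSymmetric) {v : ℝ → X}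
    (hv : ∀ μ, A (v μ) = (μ : 𝕜) • v μ) {x : X} (h : HasSum v x) (μ : ℝ) :
    eigenProj A μ x = v μ := by
  have h1 := (h.mapL (eigenProj A μ)).tsum_eq
  rw [tsum_eq_single μ fun ν hν => eigenProj_of_apply_eq_of_ne hS hν (hv ν),
    eigenProj_of_apply_eq (hv μ)] at h1
  exact h1.symm

theorem hasSum_eigenProj (hA : IsCompactOperator A) (hS : (A : X →ₗ[𝕜] X).IsSymmetric) (x : X) :
    HasSum (fun μ => eigenProj A μ x) x := by
  have H := isHilbertSum_ker hA hS
  have h := H.hasSum_linearIsometryEquiv_symm (H.linearIsometryEquiv x)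
  rw [LinearIsometryEquiv.symm_apply_apply] at h
  convert h using 1
  funext μ
  exact eigenProj_of_hasSum hS
    (fun ν => mem_ker_sub_smul_iff.1 (H.linearIsometryEquiv x ν).2) h μ

/-- Parseval's identity. -/
theorem hasSum_norm_sq_eigenProj (hA : IsCompactOperator A) (hS : (A : X →ₗ[𝕜] X).IsSymmetric)
    (x : X) : HasSum (fun μ => ‖eigenProj A μ x‖ ^ 2) (‖x‖ ^ 2) := by
  have h := ((hasSum_eigenProj hA hS x).mapL (innerSL 𝕜 x)).mapL (RCLike.reCLM (K := 𝕜))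
  simp only [innerSL_apply_apply, RCLike.reCLM_apply, inner_self_eq_norm_sq] at h
  refine h.congr_fun fun μ => ?_
  rw [← re_inner_eigenProj_left, inner_re_symm]

theorem exists_eigenProj_ne_zero (hA : IsCompactOperator A) (hS : (A : X →ₗ[𝕜] X).IsSymmetric)
    {x : X} (hx : x ≠ 0) : ∃ μ, eigenProj A μ x ≠ 0 := by
  by_contra! h
  have := hasSum_eigenProj hA hS x
  simp only [h] at this
  exact hx (this.unique hasSum_zero)

theorem apply_smul_eigenProj (f : ℝ → ℝ) (x : X) (μ : ℝ) :
    A ((f μ : 𝕜) • eigenProj A μ x) = (μ : 𝕜) • ((f μ : 𝕜) • eigenProj A μ x) := by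
  rw [map_smul, apply_eigenProj, smul_comm]

/-- The series defining `f(A) x` converges exactly when the squares of the norms of its orthogonal
terms are summable. -/
theorem summable_smul_eigenProj (hS : (A : X →ₗ[𝕜] X).IsSymmetric) {f : ℝ → ℝ} {x : X}
    (h : Summable fun μ => (f μ) ^ 2 * ‖eigenProj A μ x‖ ^ 2) :
    Summable fun μ => (f μ : 𝕜) • eigenProj A μ x := by
  refine ((orthogonalFamily_ker hS).summable_iff_norm_sq_summable fun μ =>
    ⟨(f μ : 𝕜) • eigenProj A μ x, ?_⟩).2 ?_
  · exact mem_ker_sub_smul_iff.2 (apply_smul_eigenProj f x μ)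
  · refine h.congr fun μ => ?_
    rw [Submodule.coe_norm, norm_smul, RCLike.norm_ofReal, mul_pow, sq_abs]

theorem eigenProj_spectralApply (hS : (A : X →ₗ[𝕜] X).IsSymmetric) {f : ℝ → ℝ} {x : X}
    (h : Summable fun μ => (f μ) ^ 2 * ‖eigenProj A μ x‖ ^ 2) (μ : ℝ) :
    eigenProj A μ (spectralApply A f x) = (f μ : 𝕜) • eigenProj A μ x :=
  eigenProj_of_hasSum hS (apply_smul_eigenProj f x) (summable_smul_eigenProj hS h).hasSum μ

theorem spectralApply_of_apply_eq (hS : (A : X →ₗ[𝕜] X).IsSymmetric) (f : ℝ → ℝ) {μ : ℝ} {x : X}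
    (hx : A x = (μ : 𝕜) • x) : spectralApply A f x = (f μ : 𝕜) • x := by
  rw [spectralApply, tsum_eq_single μ fun ν hν => by
    rw [eigenProj_of_apply_eq_of_ne hS hν.symm hx, smul_zero], eigenProj_of_apply_eq hx]

theorem ext_eigenProj (hA : IsCompactOperator A) (hS : (A : X →ₗ[𝕜] X).IsSymmetric) {x y : X}
    (h : ∀ μ, eigenProj A μ x = eigenProj A μ y) : x = y := by
  have hx := hasSum_eigenProj hA hS x
  simp only [h] at hx
  exact hx.unique (hasSum_eigenProj hA hS y)

theorem norm_eigenProj_le (A : X →L[𝕜] X) (μ : ℝ) (x : X) : ‖eigenProj A μ x‖ ≤ ‖x‖ :=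
  Submodule.norm_starProjection_apply_le _ x

/-- Coefficientwise domination of the eigenspace components dominates the norms. -/
theorem norm_le_of_norm_eigenProj_le (hA : IsCompactOperator A)
    (hS : (A : X →ₗ[𝕜] X).IsSymmetric) {x y : X} {b : ℝ} (hb : 0 ≤ b)
    (h : ∀ μ, ‖eigenProj A μ x‖ ≤ b * ‖eigenProj A μ y‖) : ‖x‖ ≤ b * ‖y‖ := by
  refine le_of_sq_le_sq ?_ (by positivity)
  rw [mul_pow]
  refine hasSum_le (fun μ => ?_) (hasSum_norm_sq_eigenProj hA hS x)
    ((hasSum_norm_sq_eigenProj hA hS y).mul_left (b ^ 2))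
  rw [← mul_pow]
  exact pow_le_pow_left₀ (norm_nonneg _) (h μ) 2

end CompactSelfAdjoint

/-! ### The regularization operators in the eigenspace decomposition -/

section NormalOp

variable {𝕜 X Y : Type*} [RCLike 𝕜]
  [NormedAddCommGroup X] [InnerProductSpace 𝕜 X] [CompleteSpace X]
  [NormedAddCommGroup Y] [InnerProductSpace 𝕜 Y] [CompleteSpace Y] {T : X →L[𝕜] Y}

theorem isCompactOperator_normalOp (hT : IsCompactOperator T) : IsCompactOperator (normalOp T) :=
  hT.clm_comp (ContinuousLinearMap.adjoint T)

theorem isSymmetric_normalOp (T : X →L[𝕜] Y) : (normalOp T : X →ₗ[𝕜] X).IsSymmetric := by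
  intro x y
  simp [normalOp, ContinuousLinearMap.adjoint_inner_left, ContinuousLinearMap.adjoint_inner_right]

theorem norm_sq_apply_of_normalOp_eq {μ : ℝ} {x : X} (hx : normalOp T x = (μ : 𝕜) • x) :
    ‖T x‖ ^ 2 = μ * ‖x‖ ^ 2 := by
  have h := ContinuousLinearMap.apply_norm_sq_eq_inner_adjoint_right T x
  change ‖T x‖ ^ 2 = RCLike.re (inner 𝕜 x (normalOp T x)) at h
  rw [h, hx, inner_smul_right, RCLike.re_ofReal_mul, inner_self_eq_norm_sq]

/-- The eigenvalues of `T* T` lie in `(0, ‖T‖²]` if `T` is injective. -/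
theorem mem_Ioc_of_normalOp_eq (hT : Function.Injective T) {μ : ℝ} {x : X}
    (hx : normalOp T x = (μ : 𝕜) • x) (hx0 : x ≠ 0) : μ ∈ Ioc 0 (‖T‖ ^ 2) := by
  have h := norm_sq_apply_of_normalOp_eq hx
  have hxp : 0 < ‖x‖ ^ 2 := by positivity
  have hTx : 0 < ‖T x‖ := norm_pos_iff.2 fun h0 => hx0 (hT (by rw [h0, map_zero]))
  refine ⟨pos_of_mul_pos_left (h ▸ by positivity) hxp.le, le_of_mul_le_mul_right ?_ hxp⟩
  rw [← h, ← mul_pow]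
  exact pow_le_pow_left₀ (norm_nonneg _) (T.le_opNorm x) 2

theorem eigenProj_normalOp_eq_zero (hT : Function.Injective T) {μ : ℝ}
    (hμ : μ ∉ Ioc 0 (‖T‖ ^ 2)) (x : X) : eigenProj (normalOp T) μ x = 0 := by
  by_contra h
  exact hμ (mem_Ioc_of_normalOp_eq hT (apply_eigenProj _ μ x) h)

theorem summable_sq_mul (hTc : IsCompactOperator T) (hT : Function.Injective T) {f : ℝ → ℝ}
    {b : ℝ} (hb : ∀ μ ∈ Ioc 0 (‖T‖ ^ 2), |f μ| ≤ b) (x : X) :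
    Summable fun μ => (f μ) ^ 2 * ‖eigenProj (normalOp T) μ x‖ ^ 2 := by
  have hP := hasSum_norm_sq_eigenProj (isCompactOperator_normalOp hTc) (isSymmetric_normalOp T) x
  refine Summable.of_nonneg_of_le (fun μ => by positivity) (fun μ => ?_)
    (hP.summable.mul_left (b ^ 2))
  by_cases hμ : μ ∈ Ioc 0 (‖T‖ ^ 2)
  · refine mul_le_mul_of_nonneg_right ?_ (by positivity)
    exact sq_le_sq' (neg_le_of_abs_le (hb μ hμ)) (le_of_abs_le (hb μ hμ))
  · simp [eigenProj_normalOp_eq_zero hT hμ]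

/-- A Bessel inequality in `Y`: the vectors `T P_μ T* y` are orthogonal, of norm
`√μ ‖P_μ T* y‖`. -/
theorem sum_norm_sq_eigenProj_adjoint_le (T : X →L[𝕜] Y) (y : Y) (F : Finset ℝ) :
    ∑ μ ∈ F, μ⁻¹ * ‖eigenProj (normalOp T) μ (ContinuousLinearMap.adjoint T y)‖ ^ 2 ≤
      ‖y‖ ^ 2 := by
  set A := normalOp T with hA
  have hS : (A : X →ₗ[𝕜] X).IsSymmetric := isSymmetric_normalOp T
  set u := ContinuousLinearMap.adjoint T y with hu
  set s := ∑ μ ∈ F, μ⁻¹ * ‖eigenProj A μ u‖ ^ 2 with hs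
  set v := ∑ μ ∈ F, ((μ⁻¹ : ℝ) : 𝕜) • eigenProj A μ u with hv
  have h1 : RCLike.re (inner 𝕜 v u) = s := by
    simp only [hv, hs, sum_inner, map_sum, inner_smul_left, RCLike.conj_ofReal,
      RCLike.re_ofReal_mul, re_inner_eigenProj_left]
  have hPv : ∀ μ ∈ F, eigenProj A μ v = ((μ⁻¹ : ℝ) : 𝕜) • eigenProj A μ u := by
    intro μ hμ
    rw [hv, map_sum, Finset.sum_eq_single_of_mem μ hμ fun ν _ hν => by
      rw [map_smul, eigenProj_eigenProj_of_ne hS hν, smul_zero], map_smul,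
      eigenProj_of_apply_eq (apply_eigenProj A μ u)]
  have h2 : ‖T v‖ ^ 2 = s := by
    have h := ContinuousLinearMap.apply_norm_sq_eq_inner_adjoint_left T v
    change ‖T v‖ ^ 2 = RCLike.re (inner 𝕜 (A v) v) at h
    rw [h, inner_re_symm]
    have h3 : ∀ μ ∈ F, RCLike.re (inner 𝕜 v (A (((μ⁻¹ : ℝ) : 𝕜) • eigenProj A μ u))) =
        μ⁻¹ * ‖eigenProj A μ u‖ ^ 2 := by
      intro μ hμ
      rw [← hPv μ hμ, apply_eigenProj, inner_smul_right, RCLike.re_ofReal_mul, inner_re_symm,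
        re_inner_eigenProj_left, hPv μ hμ, norm_smul, RCLike.norm_ofReal, mul_pow, sq_abs]
      by_cases h0 : μ = 0
      · simp [h0]
      · field_simp
    conv_lhs => enter [2, 3]; rw [hv]
    rw [map_sum, inner_sum, map_sum]
    exact Finset.sum_congr rfl h3
  have h4 : s ≤ ‖T v‖ * ‖y‖ := by
    rw [← h1, hu, ContinuousLinearMap.adjoint_inner_right]
    exact re_inner_le_norm _ _
  have h5 : ‖T v‖ ≤ ‖y‖ := by
    by_contra! h
    have : 0 < ‖T v‖ := (norm_nonneg _).trans_lt h
    nlinarith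
  rw [← h2]
  exact pow_le_pow_left₀ (norm_nonneg _) h5 2

/-- The operator `g(T* T) T*` is bounded by the supremum of `√λ |g(λ)|`. -/
theorem norm_spectralReg_le (hTc : IsCompactOperator T) (hT : Function.Injective T)
    {g : ℝ → ℝ → ℝ} {α b : ℝ} (hb0 : 0 ≤ b) (hb : ∀ μ ∈ Ioc 0 (‖T‖ ^ 2), √μ * |g α μ| ≤ b)
    (y : Y) : (Summable fun μ => (g α μ) ^ 2 *
      ‖eigenProj (normalOp T) μ (ContinuousLinearMap.adjoint T y)‖ ^ 2) ∧
      ‖spectralReg T g α y‖ ≤ b * ‖y‖ := by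
  have hAc := isCompactOperator_normalOp hTc
  have hS := isSymmetric_normalOp T
  set u := ContinuousLinearMap.adjoint T y with hu
  have hle : ∀ μ, (g α μ) ^ 2 * ‖eigenProj (normalOp T) μ u‖ ^ 2 ≤
      b ^ 2 * (μ⁻¹ * ‖eigenProj (normalOp T) μ u‖ ^ 2) := by
    intro μ
    by_cases hμ : μ ∈ Ioc 0 (‖T‖ ^ 2)
    · have h0 : 0 < μ := hμ.1
      have h1 : μ * (g α μ) ^ 2 ≤ b ^ 2 := by
        have := pow_le_pow_left₀ (by positivity) (hb μ hμ) 2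
        rwa [mul_pow, Real.sq_sqrt h0.le, sq_abs] at this
      rw [← mul_assoc]
      gcongr
      rwa [← div_eq_mul_inv, le_div_iff₀ h0, mul_comm]
    · simp [eigenProj_normalOp_eq_zero hT hμ]
  have hfin : ∀ F : Finset ℝ, ∑ μ ∈ F, (g α μ) ^ 2 * ‖eigenProj (normalOp T) μ u‖ ^ 2 ≤
      b ^ 2 * ‖y‖ ^ 2 := fun F => by
    refine (Finset.sum_le_sum fun μ _ => hle μ).trans ?_
    rw [← Finset.mul_sum]
    gcongr
    exact sum_norm_sq_eigenProj_adjoint_le T y F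
  have hsum := summable_of_sum_le (fun μ => by positivity) hfin
  refine ⟨hsum, le_of_sq_le_sq ?_ (by positivity)⟩
  refine hasSum_le_of_sum_le (hasSum_norm_sq_eigenProj hAc hS _) fun F => ?_
  rw [mul_pow]
  refine (Finset.sum_congr rfl fun μ _ => ?_).trans_le (hfin F)
  rw [spectralReg, eigenProj_spectralApply hS hsum, norm_smul, RCLike.norm_ofReal, mul_pow, sq_abs]

/-- `g(T* T) T* T x` exists as soon as `λ g(λ)` is bounded. -/
theorem summable_spectralReg_apply (hTc : IsCompactOperator T) (hT : Function.Injective T)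
    {g : ℝ → ℝ → ℝ} {α C : ℝ} (hC : ∀ μ ∈ Ioc 0 (‖T‖ ^ 2), |μ * g α μ| ≤ C) (x : X) :
    Summable fun μ => (g α μ) ^ 2 *
      ‖eigenProj (normalOp T) μ (ContinuousLinearMap.adjoint T (T x))‖ ^ 2 := by
  convert summable_sq_mul hTc hT hC x using 2 with μ
  change (g α μ) ^ 2 * ‖eigenProj (normalOp T) μ (normalOp T x)‖ ^ 2 = _
  rw [eigenProj_apply (isSymmetric_normalOp T), norm_smul, RCLike.norm_ofReal, mul_pow, sq_abs]
  ring

/-- The error for exact data is `R_α T x - x = -r_α(T* T) x`. -/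
theorem eigenProj_spectralReg_sub (hTc : IsCompactOperator T) (hT : Function.Injective T)
    {g : ℝ → ℝ → ℝ} {α C : ℝ} (hC : ∀ μ ∈ Ioc 0 (‖T‖ ^ 2), |μ * g α μ| ≤ C) (x : X) (μ : ℝ) :
    eigenProj (normalOp T) μ (spectralReg T g α (T x) - x) =
      ((-residual g α μ : ℝ) : 𝕜) • eigenProj (normalOp T) μ x := by
  have hS := isSymmetric_normalOp T
  have h : eigenProj (normalOp T) μ (ContinuousLinearMap.adjoint T (T x)) =
      (μ : 𝕜) • eigenProj (normalOp T) μ x := eigenProj_apply hS μ x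
  rw [map_sub, spectralReg, eigenProj_spectralApply hS (summable_spectralReg_apply hTc hT hC x),
    h, residual, smul_smul, neg_sub, RCLike.ofReal_sub, sub_smul, RCLike.ofReal_one, one_smul,
    RCLike.ofReal_mul, mul_comm]

theorem norm_eigenProj_spectralReg_sub (hTc : IsCompactOperator T) (hT : Function.Injective T)
    {g : ℝ → ℝ → ℝ} {α C : ℝ} (hC : ∀ μ ∈ Ioc 0 (‖T‖ ^ 2), |μ * g α μ| ≤ C) (x : X) (μ : ℝ) :
    ‖eigenProj (normalOp T) μ (spectralReg T g α (T x) - x)‖ =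
      |residual g α μ| * ‖eigenProj (normalOp T) μ x‖ := by
  rw [eigenProj_spectralReg_sub hTc hT hC, norm_smul, RCLike.norm_ofReal, abs_neg]

theorem spectralApply_add {A : X →L[𝕜] X} {f : ℝ → ℝ} {x y : X}
    (hx : Summable fun μ => (f μ : 𝕜) • eigenProj A μ x)
    (hy : Summable fun μ => (f μ : 𝕜) • eigenProj A μ y) :
    spectralApply A f (x + y) = spectralApply A f x + spectralApply A f y := by
  simp only [spectralApply, map_add, smul_add]
  exact hx.tsum_add hy

theorem normalOp_adjoint_apply {μ : ℝ} {y : Y}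
    (hy : T (ContinuousLinearMap.adjoint T y) = (μ : 𝕜) • y) :
    normalOp T (ContinuousLinearMap.adjoint T y) =
      (μ : 𝕜) • ContinuousLinearMap.adjoint T y := by
  simp [normalOp, hy]

theorem norm_adjoint_apply {μ : ℝ} {y : Y} (hμ : 0 ≤ μ)
    (hy : T (ContinuousLinearMap.adjoint T y) = (μ : 𝕜) • y) :
    ‖ContinuousLinearMap.adjoint T y‖ = √μ * ‖y‖ := by
  have h : ‖ContinuousLinearMap.adjoint T y‖ ^ 2 = μ * ‖y‖ ^ 2 := by
    rw [← inner_self_eq_norm_sq (𝕜 := 𝕜), ContinuousLinearMap.adjoint_inner_left, hy,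
      inner_smul_right, RCLike.re_ofReal_mul, inner_self_eq_norm_sq]
  rw [← Real.sqrt_sq (norm_nonneg (ContinuousLinearMap.adjoint T y)), h, Real.sqrt_mul hμ,
    Real.sqrt_sq (norm_nonneg _)]

/-- On the data `T x + y`, with `y` an eigenvector of `T T*`, the operator `R_α` is additive even
if it is not known to be bounded. -/
theorem spectralReg_add (hTc : IsCompactOperator T) (hT : Function.Injective T)
    {g : ℝ → ℝ → ℝ} {α C : ℝ} (hC : ∀ μ ∈ Ioc 0 (‖T‖ ^ 2), |μ * g α μ| ≤ C) (x : X) {μ : ℝ} {y : Y}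
    (hy : T (ContinuousLinearMap.adjoint T y) = (μ : 𝕜) • y) :
    spectralReg T g α (T x + y) =
      spectralReg T g α (T x) + (g α μ : 𝕜) • ContinuousLinearMap.adjoint T y := by
  have hS := isSymmetric_normalOp T
  have hy' := normalOp_adjoint_apply hy
  rw [spectralReg, map_add, spectralApply_add
    (summable_smul_eigenProj hS (summable_spectralReg_apply hTc hT hC x)) ?_,
    spectralApply_of_apply_eq hS _ hy', spectralReg]
  refine summable_of_ne_finset_zero (s := {μ}) fun ν hν => ?_
  rw [eigenProj_of_apply_eq_of_ne hS (Ne.symm (by simpa using hν)) hy', smul_zero]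

end NormalOp

/-! ### The total error -/

section TotalError

variable {X Y : Type*} [NormedAddCommGroup X] [NormedAddCommGroup Y]
  {T : X → Y} {R : ℝ → Y → X} {α₀ δ b : ℝ} {x : X}

theorem iSup_enorm_sub_le {α : ℝ} (h : ∀ y ∈ Metric.closedBall (T x) δ, ‖R α y - x‖ ≤ b) :
    ⨆ y ∈ Metric.closedBall (T x) δ, ‖R α y - x‖ₑ ≤ ENNReal.ofReal b :=
  iSup₂_le fun y hy => by
    rw [← ofReal_norm]
    exact ENNReal.ofReal_le_ofReal (h y hy)

theorem totalError_le (hb : 0 ≤ b) {α : ℝ} (hα : α ∈ Ioo 0 α₀)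
    (h : ∀ y ∈ Metric.closedBall (T x) δ, ‖R α y - x‖ ≤ b) :
    totalError T R α₀ x δ ≤ b :=
  ENNReal.toReal_le_of_le_ofReal hb ((iInf₂_le α hα).trans (iSup_enorm_sub_le h))

/-- A bound for the total error is attained, up to an arbitrarily small excess, by an admissible
parameter. The hypothesis `hfin` excludes that the total error is `0` for the reason that the
extended infimum is infinite. -/
theorem exists_of_totalError_lt
    (hfin : ∃ α ∈ Ioo 0 α₀, ∃ C : ℝ, ∀ y ∈ Metric.closedBall (T x) δ, ‖R α y - x‖ ≤ C)
    (h : totalError T R α₀ x δ < b) :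
    ∃ α ∈ Ioo 0 α₀, ∀ y ∈ Metric.closedBall (T x) δ, ‖R α y - x‖ ≤ b := by
  obtain ⟨α₁, hα₁, C, hC⟩ := hfin
  have hne : (⨅ α ∈ Ioo 0 α₀, ⨆ y ∈ Metric.closedBall (T x) δ, ‖R α y - x‖ₑ) ≠ ⊤ :=
    ne_top_of_le_ne_top ENNReal.ofReal_ne_top ((iInf₂_le α₁ hα₁).trans (iSup_enorm_sub_le hC))
  have h0 : 0 < b := ENNReal.toReal_nonneg.trans_lt h
  have hlt := (ENNReal.lt_ofReal_iff_toReal_lt hne).2 h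
  simp only [iInf_lt_iff] at hlt
  obtain ⟨α, hα, hlt⟩ := hlt
  refine ⟨α, hα, fun y hy => ?_⟩
  have h1 := (le_iSup₂ (f := fun y (_ : y ∈ Metric.closedBall (T x) δ) => ‖R α y - x‖ₑ)
    y hy).trans hlt.le
  rwa [← ofReal_norm, ENNReal.ofReal_le_ofReal_iff h0.le] at h1

end TotalError

/-! ### Bounds for the regularization operators -/

/-- A sequence decreasing to `0` with ratios of consecutive terms at most `c` meets every interval
`[t, c t]`. -/
theorem exists_mem_Icc_of_ratio_le {ev : ℕ → ℝ} {c : ℝ} (hpos : ∀ n, 0 < ev n)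
    (hlim : Tendsto ev atTop (𝓝 0)) (hratio : ∀ n, ev n / ev (n + 1) ≤ c) {t : ℝ} (ht : 0 < t)
    (ht0 : t ≤ ev 0) : ∃ n, ev n ∈ Icc t (c * t) := by
  have hex : ∃ n, ev n < t := (hlim.eventually (gt_mem_nhds ht)).exists
  classical
  obtain ⟨n, hn⟩ : ∃ n, Nat.find hex = n + 1 :=
    Nat.exists_eq_succ_of_ne_zero fun h => (Nat.find_spec hex).not_ge (by rwa [h])
  have h1 : ev (n + 1) < t := hn ▸ Nat.find_spec hex
  have h2 : t ≤ ev n := not_lt.1 (Nat.find_min hex (by omega))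
  refine ⟨n, h2, ?_⟩
  have h3 := (div_le_iff₀ (hpos (n + 1))).1 (hratio n)
  have hc : 0 ≤ c := (div_pos (hpos n) (hpos (n + 1))).le.trans (hratio n)
  exact h3.trans (mul_le_mul_of_nonneg_left h1.le hc)

/-- The quantities `√λ |g_α(λ)|`, for eigenvalues `λ` of `T T*`, are at least of order `1 / √α`.
The eigenvalue is chosen in `[c₁ α, c c₁ α]`, and `g_α` is compared there with `g_α'` for
`α' = λ / c₁ ≥ α`. -/
theorem exists_le_sqrt_mul_abs {α₀ b l₁ γ₂ c₁ c : ℝ} {g : ℝ → ℝ → ℝ} {ev : ℕ → ℝ}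
    (hα₀ : 0 < α₀) (hpos : ∀ n, 0 < ev n)
    (hlim : Tendsto ev atTop (𝓝 0)) (hratio : ∀ n, ev n / ev (n + 1) ≤ c) (hc : 1 ≤ c)
    (hl₁ : 0 < l₁) (hl₁b : l₁ ≤ b) (hγ₂ : 0 < γ₂) (hc₁ : 1 < c₁)
    (hnonneg : ∀ α ∈ Ioo 0 α₀, ∀ l ∈ Icc 0 l₁, 0 ≤ residual g α l)
    (hmono : ∀ l ∈ Ioc 0 b, MonotoneOn (fun α => |residual g α l|) (Ioo 0 α₀))
    (hlow : ∀ α ∈ Ioo 0 α₀, c₁ * α ≤ l₁ → γ₂ / α ≤ g α (c₁ * α)) :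
    ∃ q > 0, ∃ τ > 0, ∀ α ∈ Ioo 0 α₀, α < τ → ∃ n, q / √α ≤ √(ev n) * |g α (ev n)| := by
  have hcpos : 0 < c := one_pos.trans_le hc
  have hc₁pos : 0 < c₁ := one_pos.trans hc₁
  refine ⟨γ₂ * c₁ / √(c * c₁), by positivity,
    min (ev 0 / c₁) (min (l₁ / (c * c₁)) (α₀ / c)), ?_, fun α hα hατ => ?_⟩
  · have := hpos 0
    positivity
  obtain ⟨hα1, hα2⟩ := lt_min_iff.1 hατ
  obtain ⟨hα2, hα3⟩ := lt_min_iff.1 hα2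
  rw [lt_div_iff₀ (by positivity)] at hα1 hα2 hα3
  have hαpos := hα.1
  obtain ⟨n, hn1, hn2⟩ := exists_mem_Icc_of_ratio_le hpos hlim hratio (t := c₁ * α)
    (by positivity) (by linarith)
  set μ := ev n with hμ
  have hμpos : 0 < μ := hpos n
  have hμl : μ ≤ l₁ := by nlinarith
  set α' := μ / c₁ with hα'
  have hμα' : c₁ * α' = μ := by rw [hα']; field_simp
  have hα'pos : 0 < α' := by positivity
  have hαα' : α ≤ α' := by
    rw [hα', le_div_iff₀ hc₁pos]; linarith
  have hα'α₀ : α' < α₀ := by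
    rw [hα', div_lt_iff₀ hc₁pos]
    nlinarith
  have hα'm : α' ∈ Ioo 0 α₀ := ⟨hα'pos, hα'α₀⟩
  have h1 : residual g α μ ≤ residual g α' μ := by
    have := hmono μ ⟨hμpos, hμl.trans hl₁b⟩ hα hα'm hαα'
    simp only at this
    rwa [abs_of_nonneg (hnonneg α hα μ ⟨hμpos.le, hμl⟩),
      abs_of_nonneg (hnonneg α' hα'm μ ⟨hμpos.le, hμl⟩)] at this
  have h2 : g α' μ ≤ g α μ := by
    refine le_of_mul_le_mul_left ?_ hμpos
    simp only [residual] at h1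
    linarith
  have h3 : γ₂ / α' ≤ g α' μ := by
    have := hlow α' hα'm (by rw [hμα']; exact hμl)
    rwa [hμα'] at this
  have h4 : γ₂ * c₁ / μ ≤ |g α μ| := by
    refine le_trans (le_of_eq ?_) ((h3.trans h2).trans (le_abs_self _))
    rw [hα']
    field_simp
  refine ⟨n, ?_⟩
  calc γ₂ * c₁ / √(c * c₁) / √α = γ₂ * c₁ / √(c * (c₁ * α)) := by
        rw [div_div, ← Real.sqrt_mul (by positivity), mul_assoc c]
    _ ≤ γ₂ * c₁ / √μ := by gcongr
    _ = √μ * (γ₂ * c₁ / μ) := by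
        nth_rw 3 [← Real.mul_self_sqrt hμpos.le]
        have : √μ ≠ 0 := by positivity
        field_simp
    _ ≤ √μ * |g α μ| := by gcongr

section Spectral

variable {𝕜 X Y : Type*} [RCLike 𝕜]
  [NormedAddCommGroup X] [InnerProductSpace 𝕜 X] [CompleteSpace X]
  [NormedAddCommGroup Y] [InnerProductSpace 𝕜 Y] [CompleteSpace Y] {T : X →L[𝕜] Y}

/-- A bound for the worst-case error bounds the noise amplification. The two data `T x` and
`T x + e`, with `e` an eigenvector of `T T*` of norm `δ`, are compared. -/
theorem mul_sqrt_mul_abs_le (hTc : IsCompactOperator T) (hT : Function.Injective T)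
    {g : ℝ → ℝ → ℝ} {α C δ b μ : ℝ} (hC : ∀ μ ∈ Ioc 0 (‖T‖ ^ 2), |μ * g α μ| ≤ C) (hδ : 0 ≤ δ)
    {x : X} (hb : ∀ y ∈ Metric.closedBall (T x) δ, ‖spectralReg T g α y - x‖ ≤ b)
    (hμ0 : 0 ≤ μ)
    (hμ : Module.End.HasEigenvalue
      ((T.comp (ContinuousLinearMap.adjoint T) : Y →L[𝕜] Y) : Y →ₗ[𝕜] Y) (μ : 𝕜)) :
    δ * (√μ * |g α μ|) ≤ 2 * b := by
  obtain ⟨v, hv, hv0⟩ := hμ.exists_hasEigenvector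
  rw [Module.End.mem_eigenspace_iff] at hv
  have hvn : 0 < ‖v‖ := norm_pos_iff.2 hv0
  set e : Y := ((δ / ‖v‖ : ℝ) : 𝕜) • v with he
  have hen : ‖e‖ = δ := by
    rw [he, norm_smul, RCLike.norm_ofReal, abs_of_nonneg (by positivity)]
    field_simp
  have hev : T (ContinuousLinearMap.adjoint T e) = (μ : 𝕜) • e := by
    have : T (ContinuousLinearMap.adjoint T v) = (μ : 𝕜) • v := hv
    rw [he, map_smul, map_smul, this, smul_comm]
  have h1 := hb (T x + e) (by simp [hen])
  have h2 := hb (T x) (Metric.mem_closedBall_self hδ)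
  have h3 : ‖(g α μ : 𝕜) • ContinuousLinearMap.adjoint T e‖ ≤ b + b := by
    have h := (norm_sub_le (spectralReg T g α (T x + e) - x) (spectralReg T g α (T x) - x)).trans
      (add_le_add h1 h2)
    rwa [spectralReg_add hTc hT hC x hev, sub_sub_sub_cancel_right, add_sub_cancel_left] at h
  rw [norm_smul, RCLike.norm_ofReal, norm_adjoint_apply hμ0 hev, hen] at h3
  linarith

/-- Conversely, the worst-case error is at most the error for exact data plus the noise level
times `sup √λ |g_α(λ)|`. -/
theorem norm_spectralReg_sub_le (hTc : IsCompactOperator T) (hT : Function.Injective T)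
    {g : ℝ → ℝ → ℝ} {α C δ b : ℝ} (hC : ∀ μ ∈ Ioc 0 (‖T‖ ^ 2), |μ * g α μ| ≤ C) (hb0 : 0 ≤ b)
    (hb : ∀ μ ∈ Ioc 0 (‖T‖ ^ 2), √μ * |g α μ| ≤ b) (x : X) {y : Y}
    (hy : y ∈ Metric.closedBall (T x) δ) :
    ‖spectralReg T g α y - x‖ ≤ ‖spectralReg T g α (T x) - x‖ + b * δ := by
  have hS := isSymmetric_normalOp T
  have hsub := norm_spectralReg_le hTc hT hb0 hb (y - T x)
  have hadd : spectralReg T g α y =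
      spectralReg T g α (T x) + spectralReg T g α (y - T x) := by
    have h := spectralApply_add (summable_smul_eigenProj hS
      (summable_spectralReg_apply hTc hT hC x)) (summable_smul_eigenProj hS hsub.1)
    rw [← map_add, add_sub_cancel] at h
    exact h
  rw [mem_closedBall_iff_norm] at hy
  rw [hadd, add_sub_right_comm]
  refine (norm_add_le _ _).trans ?_
  gcongr
  exact hsub.2.trans (by gcongr)

/-- The error for exact data increases with the parameter. -/
theorem norm_spectralReg_sub_mono (hTc : IsCompactOperator T) (hT : Function.Injective T)
    {g : ℝ → ℝ → ℝ} {α₀ C : ℝ}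
    (hC : ∀ α ∈ Ioo 0 α₀, ∀ μ ∈ Ioc 0 (‖T‖ ^ 2), |μ * g α μ| ≤ C)
    (hmono : ∀ l ∈ Ioc 0 (‖T‖ ^ 2), MonotoneOn (fun α => |residual g α l|) (Ioo 0 α₀))
    {α α' : ℝ} (hα : α ∈ Ioo 0 α₀) (hα' : α' ∈ Ioo 0 α₀) (hαα' : α ≤ α') (x : X) :
    ‖spectralReg T g α (T x) - x‖ ≤ ‖spectralReg T g α' (T x) - x‖ := by
  rw [← one_mul ‖spectralReg T g α' (T x) - x‖]
  refine norm_le_of_norm_eigenProj_le (isCompactOperator_normalOp hTc) (isSymmetric_normalOp T)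
    zero_le_one fun μ => ?_
  rw [norm_eigenProj_spectralReg_sub hTc hT (hC α hα),
    norm_eigenProj_spectralReg_sub hTc hT (hC α' hα'), one_mul]
  by_cases hμ : μ ∈ Ioc 0 (‖T‖ ^ 2)
  · exact mul_le_mul_of_nonneg_right (hmono μ hμ hα hα' hαα') (norm_nonneg _)
  · simp [eigenProj_normalOp_eq_zero hT hμ]

theorem abs_le_of_monotoneOn {ρ : ℝ → ℝ} {b : ℝ} (hpos : ∀ l ∈ Ioc 0 b, 0 < ρ l)
    (hmono : MonotoneOn ρ (Ioc 0 b)) {l : ℝ} (hl : l ∈ Ioc 0 b) : |ρ l| ≤ ρ b := by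
  rw [abs_of_pos (hpos l hl)]
  exact hmono hl (right_mem_Ioc.2 (hl.1.trans_le hl.2)) hl.2

/-- A qualification bounds the error for exact data on the source set. -/
theorem norm_spectralReg_sub_le_of_qualification (hTc : IsCompactOperator T)
    (hT : Function.Injective T) {g : ℝ → ℝ → ℝ} {α C γ : ℝ} {ρ : ℝ → ℝ}
    (hC : ∀ μ ∈ Ioc 0 (‖T‖ ^ 2), |μ * g α μ| ≤ C)
    (hpos : ∀ l ∈ Ioc 0 (‖T‖ ^ 2), 0 < ρ l) (hmono : MonotoneOn ρ (Ioc 0 (‖T‖ ^ 2)))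
    (hγ : ∀ l ∈ Ioc 0 (‖T‖ ^ 2), |residual g α l| * ρ l ≤ γ * ρ α) (hγρ : 0 ≤ γ * ρ α) (w : X) :
    ‖spectralReg T g α (T (spectralApply (normalOp T) ρ w)) - spectralApply (normalOp T) ρ w‖ ≤
      γ * ρ α * ‖w‖ := by
  have hS := isSymmetric_normalOp T
  refine norm_le_of_norm_eigenProj_le (isCompactOperator_normalOp hTc) hS hγρ fun μ => ?_
  rw [norm_eigenProj_spectralReg_sub hTc hT hC, eigenProj_spectralApply hS
    (summable_sq_mul hTc hT (fun l hl => abs_le_of_monotoneOn hpos hmono hl) w), norm_smul,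
    RCLike.norm_ofReal, ← mul_assoc]
  by_cases hμ : μ ∈ Ioc 0 (‖T‖ ^ 2)
  · rw [abs_of_pos (hpos μ hμ)]
    exact mul_le_mul_of_nonneg_right (hγ μ hμ) (norm_nonneg _)
  · simp [eigenProj_normalOp_eq_zero hT hμ]

/-- A converse result: if the error for exact data is of order `ρ(α)`, then `x` is in the range of
`ρ(T* T)`. Since `|r_α(λ)| / ρ(α) ≥ a / ρ(λ)` for `α ≤ λ / k`, the partial sums of the series of
`‖ρ(T* T)⁻¹ x‖²` are bounded. -/
theorem mem_range_spectralApply (hTc : IsCompactOperator T)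
    (hT : Function.Injective T) {g : ℝ → ℝ → ℝ} {α₀ C K a k s₀ : ℝ} {ρ : ℝ → ℝ}
    (hα₀T : α₀ ≤ ‖T‖ ^ 2)
    (hC : ∀ α ∈ Ioo 0 α₀, ∀ μ ∈ Ioc 0 (‖T‖ ^ 2), |μ * g α μ| ≤ C)
    (hpos : ∀ l ∈ Ioc 0 (‖T‖ ^ 2), 0 < ρ l) (hmono : MonotoneOn ρ (Ioc 0 (‖T‖ ^ 2)))
    (ha : 0 < a) (hk : 0 < k)
    (hlow : ∀ α ∈ Ioo 0 α₀, ∀ l, k * α ≤ l → l ≤ ‖T‖ ^ 2 → a ≤ ρ l * |residual g α l| / ρ α)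
    (hs₀ : 0 < s₀) (hs₀α : s₀ ≤ α₀) {x : X}
    (hK : ∀ s ∈ Ioo 0 s₀, ‖spectralReg T g s (T x) - x‖ ≤ K * ρ s) :
    x ∈ range (spectralApply (normalOp T) ρ) := by
  have hAc := isCompactOperator_normalOp hTc
  have hS := isSymmetric_normalOp T
  have hfin : ∀ F : Finset ℝ,
      ∑ μ ∈ F, ((ρ μ)⁻¹) ^ 2 * ‖eigenProj (normalOp T) μ x‖ ^ 2 ≤ (K / a) ^ 2 := by
    intro F
    obtain ⟨s, hs, hsF⟩ : ∃ s ∈ Ioo 0 s₀, ∀ μ ∈ F, 0 < μ → k * s ≤ μ := by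
      have h1 : ∀ᶠ s in 𝓝[>] (0 : ℝ), s ∈ Ioo 0 s₀ := Ioo_mem_nhdsGT hs₀
      have h2 : ∀ᶠ s in 𝓝[>] (0 : ℝ), ∀ μ ∈ F, 0 < μ → k * s ≤ μ := by
        rw [Filter.eventually_all_finset]
        intro μ _
        by_cases hμ : 0 < μ
        · filter_upwards [Ioo_mem_nhdsGT (div_pos hμ hk)] with s hs _
          have := (lt_div_iff₀ hk).1 hs.2
          linarith
        · exact Eventually.of_forall fun s h => absurd h hμ
      exact (h1.and h2).exists
    have hsα : s ∈ Ioo 0 α₀ := ⟨hs.1, hs.2.trans_le hs₀α⟩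
    have hρs : 0 < ρ s := hpos s ⟨hs.1, hsα.2.le.trans hα₀T⟩
    have hterm : ∀ μ ∈ F, ((ρ μ)⁻¹) ^ 2 * ‖eigenProj (normalOp T) μ x‖ ^ 2 ≤
        ((a * ρ s)⁻¹) ^ 2 *
          ‖eigenProj (normalOp T) μ (spectralReg T g s (T x) - x)‖ ^ 2 := by
      intro μ hμF
      rw [norm_eigenProj_spectralReg_sub hTc hT (hC s hsα)]
      by_cases hμ : μ ∈ Ioc 0 (‖T‖ ^ 2)
      · have hρμ := hpos μ hμ
        have h := hlow s hsα μ (hsF μ hμF hμ.1) hμ.2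
        rw [le_div_iff₀ hρs] at h
        rw [← mul_pow, ← mul_pow, ← mul_assoc]
        gcongr
        rw [inv_mul_eq_div, le_div_iff₀ (by positivity), inv_mul_le_iff₀ hρμ]
        exact h
      · simp [eigenProj_normalOp_eq_zero hT hμ]
    refine (Finset.sum_le_sum hterm).trans ?_
    rw [← Finset.mul_sum]
    have h1 : ∑ μ ∈ F, ‖eigenProj (normalOp T) μ (spectralReg T g s (T x) - x)‖ ^ 2 ≤
        (K * ρ s) ^ 2 :=
      (sum_le_hasSum F (fun μ _ => by positivity) (hasSum_norm_sq_eigenProj hAc hS _)).trans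
        (pow_le_pow_left₀ (norm_nonneg _) (hK s hs) 2)
    refine (mul_le_mul_of_nonneg_left h1 (by positivity)).trans (le_of_eq ?_)
    field_simp
  have hsum := summable_of_sum_le (fun μ => by positivity) hfin
  refine ⟨spectralApply (normalOp T) (fun μ => (ρ μ)⁻¹) x, ext_eigenProj hAc hS fun μ => ?_⟩
  rw [eigenProj_spectralApply hS
    (summable_sq_mul hTc hT (fun l hl => abs_le_of_monotoneOn hpos hmono hl) _),
    eigenProj_spectralApply hS hsum]
  by_cases hμ : μ ∈ Ioc 0 (‖T‖ ^ 2)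
  · have hρμ := (hpos μ hμ).ne'
    rw [smul_smul, ← RCLike.ofReal_mul, mul_inv_cancel₀ hρμ, RCLike.ofReal_one, one_smul]
  · simp [eigenProj_normalOp_eq_zero hT hμ]

theorem sourceSet_nonempty (hTc : IsCompactOperator T) (hT : Function.Injective T)
    (hT0 : 0 < ‖T‖) {ρ : ℝ → ℝ} (hpos : ∀ l ∈ Ioc 0 (‖T‖ ^ 2), 0 < ρ l) :
    (sourceSet T ρ).Nonempty := by
  have hS := isSymmetric_normalOp T
  obtain ⟨x, hx⟩ : ∃ x : X, x ≠ 0 := by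
    by_contra! h
    refine hT0.ne' (norm_eq_zero.2 ?_)
    ext x
    simp [h x]
  obtain ⟨μ, hμ⟩ := exists_eigenProj_ne_zero (isCompactOperator_normalOp hTc) hS hx
  have hAμ := apply_eigenProj (normalOp T) μ x
  refine ⟨spectralApply (normalOp T) ρ (eigenProj (normalOp T) μ x), mem_range_self _, ?_⟩
  rw [spectralApply_of_apply_eq hS ρ hAμ, mem_singleton_iff, smul_eq_zero, not_or]
  exact ⟨by exact_mod_cast (hpos μ (mem_Ioc_of_normalOp_eq hT hAμ hμ)).ne', hμ⟩

end Spectral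

/-! ### The function `Θ(t) = √t ρ(t)` and its inverse -/

section Theta

variable {ρ Θ : ℝ → ℝ} {b : ℝ}

theorem strictMonoOn_theta (hΘ : ∀ t, Θ t = √t * ρ t) (hpos : ∀ t ∈ Ioc 0 b, 0 < ρ t)
    (hmono : StrictMonoOn ρ (Ioc 0 b)) : StrictMonoOn Θ (Ioc 0 b) := by
  intro s hs t ht hst
  rw [hΘ, hΘ]
  exact mul_lt_mul'' (Real.sqrt_lt_sqrt hs.1.le hst) (hmono hs ht hst) (Real.sqrt_nonneg _)
    (hpos s hs).le

theorem bijOn_theta (hΘ : ∀ t, Θ t = √t * ρ t) (hpos : ∀ t ∈ Ioc 0 b, 0 < ρ t)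
    (hmono : StrictMonoOn ρ (Ioc 0 b)) (hcont : ContinuousOn ρ (Ioc 0 b))
    (hlim : Tendsto ρ (𝓝[>] 0) (𝓝 0)) {τ : ℝ} (hτ : τ ∈ Ioc 0 b) :
    BijOn Θ (Ioo 0 τ) (Ioo 0 (Θ τ)) := by
  have hΘm := strictMonoOn_theta hΘ hpos hmono
  have hsub : Ioo 0 τ ⊆ Ioc 0 b := fun t ht => ⟨ht.1, ht.2.le.trans hτ.2⟩
  have hΘc : ContinuousOn Θ (Ioc 0 b) := by
    rw [show Θ = fun t => √t * ρ t from funext hΘ]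
    exact Real.continuous_sqrt.continuousOn.mul hcont
  have hΘlim : Tendsto Θ (𝓝[>] 0) (𝓝 0) := by
    rw [show Θ = fun t => √t * ρ t from funext hΘ]
    have h : Tendsto (fun t => √t) (𝓝[>] (0 : ℝ)) (𝓝 √0) :=
      Real.continuous_sqrt.continuousAt.tendsto.mono_left nhdsWithin_le_nhds
    simpa using h.mul hlim
  refine ⟨fun t ht => ⟨?_, hΘm (hsub ht) hτ ht.2⟩, hΘm.injOn.mono hsub, fun y hy => ?_⟩
  · have h1 := ht.1
    have := hpos t (hsub ht)
    rw [hΘ]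
    positivity
  · have hev : ∀ᶠ s in 𝓝[>] (0 : ℝ), s ∈ Ioo 0 τ := Ioo_mem_nhdsGT hτ.1
    obtain ⟨s, hs, hsy⟩ := (hev.and (hΘlim.eventually (gt_mem_nhds hy.1))).exists
    have hc : ContinuousOn Θ (Icc s τ) :=
      hΘc.mono fun t ht => ⟨hs.1.trans_le ht.1, ht.2.trans hτ.2⟩
    obtain ⟨t, ht, hty⟩ := intermediate_value_Ioo hs.2.le hc ⟨hsy, hy.2⟩
    exact ⟨t, ⟨hs.1.trans ht.1, ht.2⟩, hty⟩

theorem invFunOn_theta_mem (hΘm : StrictMonoOn Θ (Ioc 0 b)) {τ : ℝ} (hτ : τ ∈ Ioc 0 b)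
    (hbij : BijOn Θ (Ioo 0 τ) (Ioo 0 (Θ τ))) {δ : ℝ} (hδ : δ ∈ Ioo 0 (Θ τ)) :
    Function.invFunOn Θ (Ioc 0 b) δ ∈ Ioo 0 τ ∧ Θ (Function.invFunOn Θ (Ioc 0 b) δ) = δ := by
  have hsub : Ioo 0 τ ⊆ Ioc 0 b := fun t ht => ⟨ht.1, ht.2.le.trans hτ.2⟩
  obtain ⟨t, ht, rfl⟩ := hbij.surjOn hδ
  rw [hΘm.injOn.leftInvOn_invFunOn (hsub ht)]
  exact ⟨ht, rfl⟩

/-- `ρ ∘ Θ⁻¹` is an order of convergence. -/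
theorem isOrderOn_comp_invFunOn_theta {X : Type*} (M : Set X) {ψ : X → ℝ → ℝ}
    (hψ : ∀ x δ, ψ x δ = ρ (Function.invFunOn Θ (Ioc 0 b) δ))
    (hpos : ∀ t ∈ Ioc 0 b, 0 < ρ t)
    (hmono : StrictMonoOn ρ (Ioc 0 b)) (hcont : ContinuousOn ρ (Ioc 0 b))
    (hlim : Tendsto ρ (𝓝[>] 0) (𝓝 0)) (hΘm : StrictMonoOn Θ (Ioc 0 b))
    (hbij : ∀ τ ∈ Ioc 0 b, BijOn Θ (Ioo 0 τ) (Ioo 0 (Θ τ))) {τ : ℝ} (hτ : τ ∈ Ioc 0 b)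
    (hΘpos : ∀ t ∈ Ioc 0 b, 0 < Θ t) :
    IsOrderOn M (Θ τ) ψ := by
  set I := Function.invFunOn Θ (Ioc 0 b) with hI
  have hψ' : ∀ x, ψ x = ρ ∘ I := fun x => funext (hψ x)
  have hsub : Ioo 0 τ ⊆ Ioc 0 b := fun t ht => ⟨ht.1, ht.2.le.trans hτ.2⟩
  have hIm : ∀ δ ∈ Ioo 0 (Θ τ), I δ ∈ Ioo 0 τ ∧ Θ (I δ) = δ := fun δ hδ =>
    invFunOn_theta_mem hΘm hτ (hbij τ hτ) hδ
  have hImono : StrictMonoOn I (Ioo 0 (Θ τ)) := by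
    intro δ hδ δ' hδ' h
    by_contra! hle
    have := hΘm.monotoneOn (hsub (hIm δ' hδ').1) (hsub (hIm δ hδ).1) hle
    rw [(hIm δ hδ).2, (hIm δ' hδ').2] at this
    exact this.not_gt h
  have himage : I '' Ioo 0 (Θ τ) = Ioo 0 τ := by
    refine Subset.antisymm (by rintro _ ⟨δ, hδ, rfl⟩; exact (hIm δ hδ).1) fun t ht => ?_
    exact ⟨Θ t, (hbij τ hτ).mapsTo ht, hΘm.injOn.leftInvOn_invFunOn (hsub ht)⟩
  have hIcont : ContinuousOn I (Ioo 0 (Θ τ)) := fun δ hδ =>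
    (hImono.continuousAt_of_image_mem_nhds (isOpen_Ioo.mem_nhds hδ)
      (himage ▸ isOpen_Ioo.mem_nhds (hIm δ hδ).1)).continuousWithinAt
  have hIlim : Tendsto I (𝓝[>] 0) (𝓝[>] 0) := by
    rw [(nhdsGT_basis (0 : ℝ)).tendsto_right_iff]
    intro ε hε
    have hm : min ε τ ∈ Ioc 0 b := ⟨lt_min hε hτ.1, (min_le_right _ _).trans hτ.2⟩
    filter_upwards [Ioo_mem_nhdsGT (hΘpos _ hm)] with δ hδ
    have := (invFunOn_theta_mem hΘm hm (hbij _ hm) hδ).1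
    exact ⟨this.1, this.2.trans_le (min_le_left _ _)⟩
  refine ⟨fun x _ δ hδ => ?_, fun x _ => ?_, fun x _ => ?_, fun x _ => ?_⟩
  · rw [hψ]
    exact hpos _ (hsub (hIm δ hδ).1)
  · rw [hψ']
    exact hlim.comp hIlim
  · rw [hψ']
    exact hcont.comp hIcont fun δ hδ => hsub (hIm δ hδ).1
  · rw [hψ']
    exact hmono.monotoneOn.comp hImono.monotoneOn fun δ hδ => hsub (hIm δ hδ).1

end Theta

/-! ### Error estimates at the noise level `Θ(t)` -/

section ErrorEstimates

variable {𝕜 X Y : Type*} [RCLike 𝕜]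
  [NormedAddCommGroup X] [InnerProductSpace 𝕜 X] [CompleteSpace X]
  [NormedAddCommGroup Y] [InnerProductSpace 𝕜 Y] [CompleteSpace Y] {T : X →L[𝕜] Y}

/-- Balancing of approximation error and noise: if a parameter `α` achieves the accuracy `K ρ(t)`
at the noise level `√t ρ(t)`, then it is not much smaller than `t`. -/
theorem min_mul_le_parameter (hTc : IsCompactOperator T) (hT : Function.Injective T)
    {g : ℝ → ℝ → ℝ} {α C K q τ t ρt : ℝ} {ev : ℕ → ℝ}
    (hC : ∀ μ ∈ Ioc 0 (‖T‖ ^ 2), |μ * g α μ| ≤ C)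
    (hev : ∀ n, Module.End.HasEigenvalue
      ((T.comp (ContinuousLinearMap.adjoint T) : Y →L[𝕜] Y) : Y →ₗ[𝕜] Y) (ev n : 𝕜))
    (hpos : ∀ n, 0 < ev n) (hK : 0 < K) (hq : 0 < q) (hρt : 0 < ρt)
    (hlow : α < τ → ∃ n, q / √α ≤ √(ev n) * |g α (ev n)|)
    (hα : 0 < α) (ht : t ∈ Ioo 0 τ) {x : X}
    (hx : ∀ y ∈ Metric.closedBall (T x) (√t * ρt), ‖spectralReg T g α y - x‖ ≤ K * ρt) :
    min 1 ((q / (2 * K)) ^ 2) * t ≤ α := by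
  have ht0 := ht.1
  rcases le_or_gt t α with h | h
  · exact (mul_le_of_le_one_left ht0.le (min_le_left _ _)).trans h
  · obtain ⟨n, hn⟩ := hlow (h.trans ht.2)
    have h1 := mul_sqrt_mul_abs_le hTc hT hC (by positivity) hx (hpos n).le (hev n)
    have h2 : √t * ρt * (q / √α) ≤ 2 * (K * ρt) :=
      (mul_le_mul_of_nonneg_left hn (by positivity)).trans h1
    have h3 : q / (2 * K) * √t ≤ √α := by
      have hsα : 0 < √α := Real.sqrt_pos.2 hα
      rw [← mul_div_assoc, div_le_iff₀ hsα] at h2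
      rw [div_mul_eq_mul_div, div_le_iff₀ (by positivity)]
      refine le_of_mul_le_mul_left ?_ hρt
      linarith
    refine (mul_le_mul_of_nonneg_right (min_le_right _ _) ht0.le).trans ?_
    have h4 := pow_le_pow_left₀ (by positivity) h3 2
    rwa [mul_pow, Real.sq_sqrt ht0.le, Real.sq_sqrt hα.le] at h4

/-- On the source set the parameter choice `α = t` gives an error of order `ρ(t)` at the noise
level `√t ρ(t)`. -/
theorem totalError_le_of_mem_range (hTc : IsCompactOperator T) (hT : Function.Injective T)
    {g : ℝ → ℝ → ℝ} {α₀ t C B γ : ℝ} {ρ : ℝ → ℝ}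
    (hC : ∀ μ ∈ Ioc 0 (‖T‖ ^ 2), |μ * g t μ| ≤ C)
    (hpos : ∀ l ∈ Ioc 0 (‖T‖ ^ 2), 0 < ρ l) (hmono : MonotoneOn ρ (Ioc 0 (‖T‖ ^ 2)))
    (hγ0 : 0 < γ) (hγ : ∀ l ∈ Ioc 0 (‖T‖ ^ 2), |residual g t l| * ρ l ≤ γ * ρ t)
    (hB0 : 0 ≤ B) (hB : ∀ l ∈ Ioc 0 (‖T‖ ^ 2), √l * |g t l| ≤ B / √t)
    (ht : t ∈ Ioo 0 α₀) (hρt : 0 ≤ ρ t) (w : X) :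
    totalError T (spectralReg T g) α₀ (spectralApply (normalOp T) ρ w) (√t * ρ t) ≤
      (γ * ‖w‖ + B) * ρ t := by
  refine totalError_le (by positivity) ht fun y hy => ?_
  have h1 := norm_spectralReg_sub_le hTc hT hC (by positivity) hB _ hy
  have h2 := norm_spectralReg_sub_le_of_qualification hTc hT hC hpos hmono hγ (by positivity) w
  have h3 : B / √t * (√t * ρ t) = B * ρ t := by
    have : √t ≠ 0 := (Real.sqrt_pos.2 ht.1).ne'
    field_simp
  rw [h3] at h1
  linarith

/-- No nonzero element has a total error of smaller order than `ρ(t)` at the noise level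
`√t ρ(t)`. -/
theorem exists_mul_le_totalError (hTc : IsCompactOperator T) (hT : Function.Injective T)
    {g : ℝ → ℝ → ℝ} {α₀ C q τ : ℝ} {ev : ℕ → ℝ} {ρ : ℝ → ℝ} (hα₀T : α₀ ≤ ‖T‖ ^ 2)
    (hC : ∀ α ∈ Ioo 0 α₀, ∀ μ ∈ Ioc 0 (‖T‖ ^ 2), |μ * g α μ| ≤ C)
    (hev : ∀ n, Module.End.HasEigenvalue
      ((T.comp (ContinuousLinearMap.adjoint T) : Y →L[𝕜] Y) : Y →ₗ[𝕜] Y) (ev n : 𝕜))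
    (hevpos : ∀ n, 0 < ev n) (hq : 0 < q) (hτ : τ ≤ α₀)
    (hlow : ∀ α ∈ Ioo 0 α₀, α < τ → ∃ n, q / √α ≤ √(ev n) * |g α (ev n)|)
    (hpos : ∀ l ∈ Ioc 0 (‖T‖ ^ 2), 0 < ρ l) (hmono : MonotoneOn ρ (Ioc 0 (‖T‖ ^ 2)))
    (hmax : ∀ l ∈ Ioc 0 (‖T‖ ^ 2), ∃ c : ℝ, 0 < c ∧ ∀ α ∈ Ioo 0 α₀, c ≤ |residual g α l| / ρ α)
    (hfin : ∀ x : X, ∀ δ : ℝ, ∃ α ∈ Ioo 0 α₀, ∃ D : ℝ,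
      ∀ y ∈ Metric.closedBall (T x) δ, ‖spectralReg T g α y - x‖ ≤ D)
    {z : X} (hz : z ≠ 0) :
    ∃ K > 0, ∀ t ∈ Ioo 0 τ, K * ρ t ≤ totalError T (spectralReg T g) α₀ z (√t * ρ t) := by
  obtain ⟨μ, hμ⟩ := exists_eigenProj_ne_zero (isCompactOperator_normalOp hTc)
    (isSymmetric_normalOp T) hz
  have hμm := mem_Ioc_of_normalOp_eq hT (apply_eigenProj (normalOp T) μ z) hμ
  obtain ⟨m, hm0, hm⟩ := hmax μ hμm
  have hPz : 0 < ‖eigenProj (normalOp T) μ z‖ := norm_pos_iff.2 hμ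
  set K := min (q / 2) (m * ‖eigenProj (normalOp T) μ z‖ / 2) with hK
  have hK0 : 0 < K := lt_min (by positivity) (by positivity)
  refine ⟨K, hK0, fun t ht => ?_⟩
  have htm : t ∈ Ioc 0 (‖T‖ ^ 2) := ⟨ht.1, (ht.2.le.trans hτ).trans hα₀T⟩
  have hρt := hpos t htm
  by_contra! hlt
  obtain ⟨α, hα, hx⟩ := exists_of_totalError_lt (hfin z _) hlt
  have hαm : α ∈ Ioc 0 (‖T‖ ^ 2) := ⟨hα.1, hα.2.le.trans hα₀T⟩
  have htα := min_mul_le_parameter hTc hT (hC α hα) hev hevpos hK0 hq hρt (hlow α hα) hα.1 ht hx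
  have hone : 1 ≤ (q / (2 * K)) ^ 2 := by
    refine one_le_pow₀ ((one_le_div₀ (by positivity)).2 ?_)
    have := min_le_left (q / 2) (m * ‖eigenProj (normalOp T) μ z‖ / 2)
    linarith
  rw [min_eq_left hone, one_mul] at htα
  have h1 := hx (T z) (Metric.mem_closedBall_self (by positivity))
  have h2 := (norm_eigenProj_le (normalOp T) μ _).trans h1
  rw [norm_eigenProj_spectralReg_sub hTc hT (hC α hα)] at h2
  have h3 := (le_div_iff₀ (hpos α hαm)).1 (hm α hα)
  have h4 := hmono htm hαm htα
  have h5 : m * ρ t * ‖eigenProj (normalOp T) μ z‖ ≤ K * ρ t := by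
    refine le_trans ?_ h2
    gcongr
    exact le_trans (by gcongr) h3
  have h6 : K ≤ m * ‖eigenProj (normalOp T) μ z‖ / 2 := min_le_right _ _
  have h7 : m * ‖eigenProj (normalOp T) μ z‖ ≤ K := by
    refine le_of_mul_le_mul_right ?_ hρt
    linarith
  linarith

/-- An element whose total error is of order `ρ(t)` at the noise level `√t ρ(t)` belongs to the
range of `ρ(T* T)`. -/
theorem mem_range_of_totalError_le (hTc : IsCompactOperator T) (hT : Function.Injective T)
    {g : ℝ → ℝ → ℝ} {α₀ C q τ a k β K : ℝ} {ev : ℕ → ℝ} {ρ : ℝ → ℝ} (hα₀T : α₀ ≤ ‖T‖ ^ 2)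
    (hC : ∀ α ∈ Ioo 0 α₀, ∀ μ ∈ Ioc 0 (‖T‖ ^ 2), |μ * g α μ| ≤ C)
    (hr : ∀ l ∈ Ioc 0 (‖T‖ ^ 2), MonotoneOn (fun α => |residual g α l|) (Ioo 0 α₀))
    (hev : ∀ n, Module.End.HasEigenvalue
      ((T.comp (ContinuousLinearMap.adjoint T) : Y →L[𝕜] Y) : Y →ₗ[𝕜] Y) (ev n : 𝕜))
    (hevpos : ∀ n, 0 < ev n) (hq : 0 < q) (hτ0 : 0 < τ) (hτ : τ ≤ α₀)
    (hlow : ∀ α ∈ Ioo 0 α₀, α < τ → ∃ n, q / √α ≤ √(ev n) * |g α (ev n)|)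
    (hρ : IsLocalUpperType ρ (‖T‖ ^ 2) β) (ha : 0 < a) (hk : 0 < k)
    (hres : ∀ α ∈ Ioo 0 α₀, ∀ l, k * α ≤ l → l ≤ ‖T‖ ^ 2 → a ≤ ρ l * |residual g α l| / ρ α)
    (hfin : ∀ x : X, ∀ δ : ℝ, ∃ α ∈ Ioo 0 α₀, ∃ D : ℝ,
      ∀ y ∈ Metric.closedBall (T x) δ, ‖spectralReg T g α y - x‖ ≤ D)
    {x : X} (hK0 : 0 < K)
    (hK : ∀ t ∈ Ioo 0 τ, totalError T (spectralReg T g) α₀ x (√t * ρ t) < K * ρ t) :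
    x ∈ range (spectralApply (normalOp T) ρ) := by
  obtain ⟨d, hd0, hd⟩ := hρ.bound
  set κ := min 1 ((q / (2 * K)) ^ 2) with hκ
  have hκ0 : 0 < κ := lt_min one_pos (by positivity)
  have hκ1 : κ ≤ 1 := min_le_left _ _
  refine mem_range_spectralApply hTc hT hα₀T hC hρ.pos hρ.monotoneOn ha hk hres
    (s₀ := κ * τ) (K := K * (d * (1 / κ) ^ β)) (by positivity)
    ((mul_le_of_le_one_left hτ0.le hκ1).trans hτ) fun s hs => ?_
  obtain ⟨t, rfl⟩ : ∃ t, s = κ * t := ⟨s / κ, by field_simp⟩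
  have ht : t ∈ Ioo 0 τ := ⟨pos_of_mul_pos_right hs.1 hκ0.le, lt_of_mul_lt_mul_left hs.2 hκ0.le⟩
  have htm : t ∈ Ioc 0 (‖T‖ ^ 2) := ⟨ht.1, (ht.2.le.trans hτ).trans hα₀T⟩
  have hρt := hρ.pos t htm
  obtain ⟨α, hα, hx⟩ := exists_of_totalError_lt (hfin x _) (hK t ht)
  have hsα : κ * t ≤ α :=
    min_mul_le_parameter hTc hT (hC α hα) hev hevpos hK0 hq hρt (hlow α hα) hα.1 ht hx
  have h1 := norm_spectralReg_sub_mono hTc hT hC hr ⟨hs.1, hsα.trans_lt hα.2⟩ hα hsα x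
  have h2 := hx (T x) (Metric.mem_closedBall_self (mul_nonneg (Real.sqrt_nonneg t) hρt.le))
  have h3 := hd κ ⟨hκ0, hκ1⟩ t htm
  rw [mul_assoc]
  exact (h1.trans h2).trans (mul_le_mul_of_nonneg_left h3 hK0.le)

end ErrorEstimates

end GlobalSaturation

/-! ### The saturation function -/

theorem theorem4p9 {𝕜 X Y : Type*} [RCLike 𝕜]
    [NormedAddCommGroup X] [InnerProductSpace 𝕜 X] [CompleteSpace X]
    [NormedAddCommGroup Y] [InnerProductSpace 𝕜 Y] [CompleteSpace Y]
    (T : X →L[𝕜] Y) (hTcompact : IsCompactOperator T) (hTinj : Function.Injective T)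
    (α₀ : ℝ) (hα₀ : 0 < α₀) (hα₀T : α₀ ≤ ‖T‖ ^ 2)
    (g : ℝ → ℝ → ℝ)
    -- H1
    (h1 : ∀ α ∈ Ioo 0 α₀, GlobalSaturation.PiecewiseContinuousOn (g α) 0 (‖T‖ ^ 2))
    -- H2
    (h2 : ∃ C : ℝ, 0 < C ∧ ∀ α ∈ Ioo 0 α₀, ∀ l ∈ Icc 0 (‖T‖ ^ 2), |l * g α l| ≤ C)
    -- H3
    (h3 : ∀ l ∈ Ioc 0 (‖T‖ ^ 2), Tendsto (fun α => g α l) (𝓝[>] 0) (𝓝 (1 / l)))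
    -- H4
    (h4 : ∃ B : ℝ, ∀ᶠ α in 𝓝[>] (0 : ℝ), ∀ l ∈ Icc 0 (‖T‖ ^ 2), √l * |g α l| ≤ B / √α)
    -- M1
    (c : ℝ) (hc : 1 ≤ c) (ev : ℕ → ℝ)
    (hev : ∀ n, Module.End.HasEigenvalue
      ((T.comp (ContinuousLinearMap.adjoint T) : Y →L[𝕜] Y) : Y →ₗ[𝕜] Y) (ev n : 𝕜))
    (hev_pos : ∀ n, 0 < ev n) (hev_anti : Antitone ev) (hev_lim : Tendsto ev atTop (𝓝 0))
    (hev_ratio : ∀ n, ev n / ev (n + 1) ≤ c)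
    -- M2
    (l₁ γ₁ γ₂ c₁ : ℝ) (hl₁ : 0 < l₁) (hl₁T : l₁ ≤ ‖T‖ ^ 2) (hγ₁ : 0 < γ₁) (hγ₂ : 0 < γ₂)
    (hc₁ : 1 < c₁)
    (m2a : ∀ α ∈ Ioo 0 α₀, ∀ l ∈ Icc 0 l₁, GlobalSaturation.residual g α l ∈ Icc (0 : ℝ) 1)
    (m2b : ∀ α ∈ Ioo 0 α₀, ∀ l, 0 ≤ l → l < α → α ≤ l₁ → γ₁ ≤ GlobalSaturation.residual g α l)
    (m2c : ∀ l ∈ Ioc 0 (‖T‖ ^ 2),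
      MonotoneOn (fun α => |GlobalSaturation.residual g α l|) (Ioo 0 α₀))
    (m2d : ∀ α ∈ Ioo 0 α₀, c₁ * α ≤ l₁ → γ₂ / α ≤ g α (c₁ * α))
    (m2e : ∀ α ∈ Ioo 0 α₀, ∀ l l', α ≤ l → l ≤ l' → l' ≤ l₁ → g α l' ≤ g α l)
    -- M3
    (ρ : ℝ → ℝ) (hρ_strict : StrictMonoOn ρ (Ioc 0 (‖T‖ ^ 2)))
    (β : ℝ) (hβ : 0 ≤ β) (hρ_type : GlobalSaturation.IsLocalUpperType ρ (‖T‖ ^ 2) β)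
    (hρ_max : GlobalSaturation.IsMaximalQualification g α₀ (‖T‖ ^ 2) ρ)
    (a k : ℝ) (ha : 0 < a) (hk : 0 < k)
    (m3 : ∀ α ∈ Ioo 0 α₀, ∀ l, k * α ≤ l → l ≤ ‖T‖ ^ 2 →
      a ≤ ρ l * |GlobalSaturation.residual g α l| / ρ α)
    -- M4
    (m4 : ∀ α ∈ Ioo 0 α₀,
      ConvexOn ℝ (Ioc 0 (‖T‖ ^ 2)) (fun l => |GlobalSaturation.residual g α l| ^ 2))
    (Θ : ℝ → ℝ) (hΘ : ∀ t, Θ t = √t * ρ t)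
    (ψ : X → ℝ → ℝ)
    (hψ : ∀ x δ, ψ x δ = ρ (Function.invFunOn Θ (Ioc 0 (‖T‖ ^ 2)) δ)) :
    BijOn Θ (Ioo 0 α₀) (Ioo 0 (Θ α₀)) ∧
    GlobalSaturation.IsOrderOn (GlobalSaturation.sourceSet T ρ) (Θ α₀) ψ ∧
    GlobalSaturation.IsGlobalSaturation
      (GlobalSaturation.totalError T (GlobalSaturation.spectralReg T g) α₀)
      (GlobalSaturation.sourceSet T ρ) ψ := by
  have hb0 : 0 < ‖T‖ ^ 2 := hα₀.trans_le hα₀T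
  have hT0 : 0 < ‖T‖ := by
    by_contra! h
    rw [le_antisymm h (norm_nonneg _)] at hb0
    norm_num at hb0
  have hα₀m : α₀ ∈ Ioc 0 (‖T‖ ^ 2) := ⟨hα₀, hα₀T⟩
  obtain ⟨C, -, hC'⟩ := h2
  have hC : ∀ α ∈ Ioo 0 α₀, ∀ μ ∈ Ioc 0 (‖T‖ ^ 2), |μ * g α μ| ≤ C := fun α hα μ hμ =>
    hC' α hα μ (Ioc_subset_Icc_self hμ)
  have hpos := hρ_type.pos
  have hmono := hρ_type.monotoneOn
  have hΘpos : ∀ t ∈ Ioc 0 (‖T‖ ^ 2), 0 < Θ t := fun t ht => by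
    rw [hΘ]
    exact mul_pos (Real.sqrt_pos.2 ht.1) (hpos t ht)
  have hΘm := GlobalSaturation.strictMonoOn_theta hΘ hpos hρ_strict
  have hbij : ∀ τ ∈ Ioc 0 (‖T‖ ^ 2), BijOn Θ (Ioo 0 τ) (Ioo 0 (Θ τ)) := fun τ hτ =>
    GlobalSaturation.bijOn_theta hΘ hpos hρ_strict hρ_type.continuousOn hρ_type.tendsto hτ
  -- near `0` the noise levels are the values `√t ρ(t)`, and `ψ` is `ρ(t)` there
  have hψΘ : ∀ τ ∈ Ioc 0 α₀, ∀ δ ∈ Ioo 0 (Θ τ), ∃ t ∈ Ioo 0 τ, δ = √t * ρ t ∧ ∀ x, ψ x δ = ρ t := by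
    intro τ hτ δ hδ
    have hτm : τ ∈ Ioc 0 (‖T‖ ^ 2) := ⟨hτ.1, hτ.2.trans hα₀T⟩
    obtain ⟨h, h'⟩ := GlobalSaturation.invFunOn_theta_mem hΘm hτm (hbij τ hτm) hδ
    exact ⟨_, h, by rw [← hΘ, h'], fun x => hψ x δ⟩
  have horder : ∀ M : Set X, GlobalSaturation.IsOrderOn M (Θ α₀) ψ := fun M =>
    GlobalSaturation.isOrderOn_comp_invFunOn_theta M hψ hpos hρ_strict hρ_type.continuousOn
      hρ_type.tendsto hΘm hbij hα₀m hΘpos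
  obtain ⟨B₀, hB₀⟩ := h4
  obtain ⟨ε, hε0, hε⟩ := mem_nhdsGT_iff_exists_Ioo_subset.1 hB₀
  -- H4 does not require `B₀` to be positive
  set B := max B₀ 1 with hBdef
  have hB0 : 0 < B := one_pos.trans_le (le_max_right _ _)
  set ε' := min ε α₀ with hε'
  have hε'm : ε' ∈ Ioc 0 α₀ := ⟨lt_min hε0 hα₀, min_le_right _ _⟩
  have hB : ∀ t ∈ Ioo 0 ε', ∀ l ∈ Ioc 0 (‖T‖ ^ 2), √l * |g t l| ≤ B / √t := fun t ht l hl =>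
    (hε ⟨ht.1, ht.2.trans_le (min_le_left _ _)⟩ l (Ioc_subset_Icc_self hl)).trans
      (by gcongr; exact le_max_left _ _)
  have hfin : ∀ x : X, ∀ δ : ℝ, ∃ α ∈ Ioo 0 α₀, ∃ D : ℝ, ∀ y ∈ Metric.closedBall (T x) δ,
      ‖GlobalSaturation.spectralReg T g α y - x‖ ≤ D := by
    intro x δ
    obtain ⟨t, ht⟩ := exists_between hε'm.1
    have htα : t ∈ Ioo 0 α₀ := ⟨ht.1, ht.2.trans_le hε'm.2⟩
    exact ⟨t, htα, _, fun y hy => GlobalSaturation.norm_spectralReg_sub_le hTcompact hTinj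
      (hC t htα) (by positivity) (hB t ht) x hy⟩
  obtain ⟨q, hq, τ₀, hτ₀, hlow₀⟩ := GlobalSaturation.exists_le_sqrt_mul_abs hα₀ hev_pos hev_lim
    hev_ratio hc hl₁ hl₁T hγ₂ hc₁ (fun α hα l hl => (m2a α hα l hl).1) m2c m2d
  set τ := min τ₀ α₀ with hτdef
  have hτm : τ ∈ Ioc 0 α₀ := ⟨lt_min hτ₀ hα₀, min_le_right _ _⟩
  have hlow : ∀ α ∈ Ioo 0 α₀, α < τ → ∃ n, q / √α ≤ √(ev n) * |g α (ev n)| := fun α hα h =>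
    hlow₀ α hα (h.trans_le (min_le_left _ _))
  have hΘα₀ := hΘpos α₀ hα₀m
  have hΘτ : 0 < Θ τ := hΘpos τ ⟨hτm.1, hτm.2.trans hα₀T⟩
  have hΘε' : 0 < Θ ε' := hΘpos ε' ⟨hε'm.1, hε'm.2.trans hα₀T⟩
  refine ⟨hbij α₀ hα₀m, horder _,
    ⟨GlobalSaturation.sourceSet_nonempty hTcompact hTinj hT0 hpos, fun h => h.2 rfl,
      ⟨Θ α₀, hΘα₀, horder _⟩, ?_⟩, ?_, ?_, ?_⟩
  · -- `ψ` is an upper bound of convergence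
    obtain ⟨γ, hγ0, hγ⟩ := hρ_max.bound
    have hex : ∀ x ∈ GlobalSaturation.sourceSet T ρ, ∃ p : ℝ, 0 < p ∧ ∀ δ ∈ Ioo 0 (Θ ε'),
        GlobalSaturation.totalError T (GlobalSaturation.spectralReg T g) α₀ x δ ≤ p * ψ x δ := by
      rintro x ⟨⟨w, rfl⟩, -⟩
      refine ⟨γ * ‖w‖ + B, by positivity, fun δ hδ => ?_⟩
      obtain ⟨t, ht, rfl, hψt⟩ := hψΘ ε' hε'm δ hδ
      have htα : t ∈ Ioo 0 α₀ := ⟨ht.1, ht.2.trans_le hε'm.2⟩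
      rw [hψt]
      exact GlobalSaturation.totalError_le_of_mem_range hTcompact hTinj (hC t htα) hpos hmono hγ0
        (hγ t htα) hB0.le (hB t ht) htα (hpos t ⟨htα.1, htα.2.le.trans hα₀T⟩).le w
    choose! p hp using hex
    exact ⟨Θ ε', hΘε', p, fun x hx => (hp x hx).1, fun x hx => (hp x hx).2⟩
  · -- S1 holds even with the limit inferior
    intro z hz x hx
    obtain ⟨K, hK0, hK⟩ := GlobalSaturation.exists_mul_le_totalError hTcompact hTinj hα₀T hC hev
      hev_pos hq hτm.2 hlow hpos hmono hρ_max.maximal hfin hz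
    have hev' : ∀ᶠ δ in 𝓝[>] (0 : ℝ), (K : EReal) ≤
        ((GlobalSaturation.totalError T (GlobalSaturation.spectralReg T g) α₀ z δ / ψ x δ : ℝ) :
          EReal) := by
      filter_upwards [Ioo_mem_nhdsGT hΘτ] with δ hδ
      obtain ⟨t, ht, rfl, hψt⟩ := hψΘ τ hτm δ hδ
      rw [EReal.coe_le_coe_iff, hψt,
        le_div_iff₀ (hpos t ⟨ht.1, (ht.2.le.trans hτm.2).trans hα₀T⟩)]
      exact hK t ht
    exact (EReal.coe_pos.2 hK0).trans_le (le_limsup_of_frequently_le' hev'.frequently)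
  · have : GlobalSaturation.PrecedesOn (GlobalSaturation.sourceSet T ρ)
        (GlobalSaturation.sourceSet T ρ) ψ ψ :=
      ⟨1, one_pos, fun _ _ => 1, fun _ _ _ _ => one_pos, fun x _ x' _ δ _ => by
        rw [one_mul, hψ, hψ]⟩
    exact ⟨this, this⟩
  · rintro ⟨M', ψ', hub, ⟨hsub, r, hr, heq⟩, -, hinv, -⟩
    obtain ⟨x, hxM', hx⟩ := exists_of_ssubset hsub
    obtain ⟨x₀, hx₀⟩ := GlobalSaturation.sourceSet_nonempty hTcompact hTinj hT0 hpos
    obtain ⟨r', hr', p, hp, hE⟩ := hub.precedes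
    obtain ⟨d, hd, κ, hκ, hinv⟩ := hinv
    refine hx ⟨?_, fun h => hub.zero_notMem (h ▸ hxM')⟩
    have hp0 := hp x hxM'
    have hκ0 := hκ x hxM' x₀ (hsub.1 hx₀)
    -- by invariance the total error at `x` is at most `p(x) κ(x, x₀) ρ(t)`, for small `t`
    obtain ⟨σ, hσ0, hσ⟩ : ∃ σ > 0, ∀ t ∈ Ioo 0 σ, t < τ ∧ √t * ρ t < min r (min r' d) := by
      have hlim : Tendsto (fun t => √t * ρ t) (𝓝[>] 0) (𝓝 0) := by
        have h : Tendsto (fun t => √t) (𝓝[>] (0 : ℝ)) (𝓝 √0) :=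
          Real.continuous_sqrt.continuousAt.tendsto.mono_left nhdsWithin_le_nhds
        simpa using h.mul hρ_type.tendsto
      have h1 : ∀ᶠ t in 𝓝[>] (0 : ℝ), √t * ρ t < min r (min r' d) :=
        hlim.eventually (gt_mem_nhds (by positivity))
      have h2 : ∀ᶠ t in 𝓝[>] (0 : ℝ), t < τ :=
        (gt_mem_nhds hτm.1).filter_mono nhdsWithin_le_nhds
      obtain ⟨σ, hσ0, hσ⟩ := mem_nhdsGT_iff_exists_Ioo_subset.1 (h2.and h1)
      exact ⟨σ, hσ0, fun t ht => hσ ht⟩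
    set σ' := min σ τ with hσ'
    have hσ'0 : 0 < σ' := lt_min hσ0 hτm.1
    refine GlobalSaturation.mem_range_of_totalError_le hTcompact hTinj (τ := σ')
      (K := p x * κ x x₀ + 1) hα₀T hC m2c hev hev_pos hq hσ'0 ((min_le_right _ _).trans hτm.2)
      (fun α hα h => hlow α hα (h.trans_le (min_le_right _ _))) hρ_type ha hk m3 hfin
      (by positivity) fun t ht => ?_
    obtain ⟨htτ, hδ⟩ := hσ t ⟨ht.1, ht.2.trans_le (min_le_left _ _)⟩
    obtain ⟨hδr, hδ⟩ := lt_min_iff.1 hδ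
    obtain ⟨hδr', hδd⟩ := lt_min_iff.1 hδ
    have htm : t ∈ Ioc 0 (‖T‖ ^ 2) := ⟨ht.1, (htτ.le.trans hτm.2).trans hα₀T⟩
    have hρt := hpos t htm
    have hδ0 : 0 < √t * ρ t := mul_pos (Real.sqrt_pos.2 ht.1) hρt
    have hψt : ψ x₀ (√t * ρ t) = ρ t := by
      rw [hψ, ← hΘ, hΘm.injOn.leftInvOn_invFunOn htm]
    have h1 := hE x hxM' _ ⟨hδ0, hδr'⟩
    have h2 := hinv x hxM' x₀ (hsub.1 hx₀) _ ⟨hδ0, hδd⟩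
    rw [heq x₀ hx₀ _ ⟨hδ0, hδr⟩, hψt] at h2
    have h3 := mul_le_mul_of_nonneg_left h2 hp0.le
    nlinarith
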